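/- Let a randomized adaptive algorithm have access to a simple undirected graph $G=(\{1,\dots,n\},E)$ with $m=|E|$ edges only through an independent set (IS) oracle: a query is a set $U\subseteq\{1,\dots,n\}$, and the answer tells whether no edge of $G$ has both endpoints in $U$. For every constant $c>0$ there are a constant $C>0$, depending only on $c$, and a randomized algorithm that, given any integer $n\ge 1$, any parameter $\varepsilon>0$ and IS oracle access to any graph $G$ on $\{1,\dots,n\}$, makes at most $$C\left(\varepsilon^{-4}\log_2^5 n+n^{2/3}\,\varepsilon^{-2}\log_2^2 n\right)$$ IS queries and, with probability at least $1-1/n^{c}$, outputs a number $\widetilde m$ with $(1-\varepsilon)m\le\widetilde m\le(1+\varepsilon)m$. (The algorithm is measured by its number of queries only.) -/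

import Mathlib

/-- The answer of the independent set oracle of the graph `G` to the query `U`:
`true` if and only if no edge of `G` has both endpoints in `U`. -/
noncomputable def isOracle {n : ℕ} (G : SimpleGraph (Fin n)) (U : Finset (Fin n)) : Bool :=
  open Classical in decide (G.IsIndepSet (U : Set (Fin n)))

/-- A deterministic adaptive algorithm with access to an independent set oracle on the vertex set
`Fin n`: it either stops and outputs a number, or asks a query and continues in a way that
depends on the answer. -/
inductive ISDecisionTree (n : ℕ) : Type
  | output (r : ℝ) : ISDecisionTree n
  | query (U : Finset (Fin n)) (next : Bool → ISDecisionTree n) : ISDecisionTree n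

namespace ISDecisionTree

/-- The number that the algorithm outputs when the queries are answered according to `G`. -/
noncomputable def eval {n : ℕ} (G : SimpleGraph (Fin n)) : ISDecisionTree n → ℝ
  | output r => r
  | query U next => eval G (next (isOracle G U))

/-- The number of oracle queries that the algorithm makes when they are answered according
to `G`. -/
noncomputable def numQueries {n : ℕ} (G : SimpleGraph (Fin n)) : ISDecisionTree n → ℕ
  | output _ => 0
  | query U next => numQueries G (next (isOracle G U)) + 1

end ISDecisionTree

/-- A randomized adaptive algorithm with access to an independent set oracle: a probability
distribution over deterministic adaptive algorithms (the random choices are made by drawing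
the deterministic algorithm, independently of the input graph). -/
abbrev RandomizedISAlgorithm (n : ℕ) : Type := PMF (ISDecisionTree n)

/-- `x` is a `(1 ± ε)`-approximation of `m`. -/
def IsApprox (ε m x : ℝ) : Prop := (1 - ε) * m ≤ x ∧ x ≤ (1 + ε) * m

namespace RandomizedISAlgorithm

/-- The probability that the output of `A` on the graph `G` is a `(1 ± ε)`-approximation of the
number of edges of `G`. -/
noncomputable def successProb {n : ℕ} (A : RandomizedISAlgorithm n) (ε : ℝ)
    (G : SimpleGraph (Fin n)) : ENNReal :=
  A.toOuterMeasure {T | IsApprox ε (G.edgeSet.ncard : ℝ) (T.eval G)}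

/-- Whatever the random choices of `A` are, it makes at most `B` queries on the graph `G`. -/
def QueriesAtMost {n : ℕ} (A : RandomizedISAlgorithm n) (G : SimpleGraph (Fin n)) (B : ℝ) : Prop :=
  ∀ T ∈ A.support, (T.numQueries G : ℝ) ≤ B

end RandomizedISAlgorithm

/-! Exact counting costs `O(log n)` queries per edge (`isComputable_adjCount`). A maximal
independent subset of `U` is found by halving, the edges from the left-out set `R` to it are found
by group testing, and the count recurses into `R`. By maximality every vertex of `R` sends an edge
to the kept part, so the edges found pay for all queries.

To handle many edges, keep each vertex with probability `p = 2⁻ᵏ` and count exactly in the sample.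
When `m ≤ 4 · 4ᵏ` a sample has at most four edges in expectation, hence costs `O(log n)`. The number
of ordered adjacent pairs in a sample has variance at most `2m(4np³ + 2p²)`
(`variance_adjCount_le`), so about `np/ε²` samples give error `ε · max(m, 4ᵏ/4)` with constant
probability (`measureReal_sample_estimator_bad_le`). A median of `O(log n)` repetitions makes
failure polynomially unlikely (`exists_median_estimator`).

The scale `4ᵏ ≈ m` is unknown, so scales are tried from the largest down, and the first estimate
reaching `4ᵏ/2` is returned (`exists_last_accepted`). Sampling stops at scale `4ᴶ`, below which
edges are counted exactly. The sample numbers form a geometric series of order `n 2⁻ᴶ/ε²`, the exact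
count costs about `4ᴶ log n`, and `8ᴶ ≈ n` makes both of order `n^(2/3)`, up to the factors in `ε`
and `log n`. -/

/-! ### Composition and truncation of decision trees. -/

namespace ISDecisionTree

variable {n : ℕ}

/-- Run `T` and continue with `k` on its output. -/
def bind : ISDecisionTree n → (ℝ → ISDecisionTree n) → ISDecisionTree n
  | output r, k => k r
  | query U next, k => query U fun b => bind (next b) k

theorem eval_bind (G : SimpleGraph (Fin n)) (T : ISDecisionTree n) (k : ℝ → ISDecisionTree n) :
    (T.bind k).eval G = (k (T.eval G)).eval G := by
  induction T with
  | output r => rfl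
  | query U next ih => exact ih _

theorem numQueries_bind (G : SimpleGraph (Fin n)) (T : ISDecisionTree n)
    (k : ℝ → ISDecisionTree n) :
    (T.bind k).numQueries G = T.numQueries G + (k (T.eval G)).numQueries G := by
  induction T with
  | output r => simp [bind, numQueries, eval]
  | query U next ih => simp [bind, numQueries, eval, ih, add_right_comm]

/-- Run `T` for at most `b` queries; if it has not stopped by then, output `r`. -/
def truncate (r : ℝ) : ℕ → ISDecisionTree n → ISDecisionTree n
  | _, output x => output x
  | 0, query _ _ => output r
  | b + 1, query U next => query U fun a => truncate r b (next a)

theorem numQueries_truncate_le (r : ℝ) (G : SimpleGraph (Fin n)) (b : ℕ) (T : ISDecisionTree n) :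
    (T.truncate r b).numQueries G ≤ b := by
  induction T generalizing b with
  | output x => simp [truncate, numQueries]
  | query U next ih =>
    cases b with
    | zero => simp [truncate, numQueries]
    | succ b => simpa [truncate, numQueries] using ih _ b

theorem eval_truncate_of_le (r : ℝ) (G : SimpleGraph (Fin n)) (b : ℕ) (T : ISDecisionTree n)
    (h : T.numQueries G ≤ b) : (T.truncate r b).eval G = T.eval G := by
  induction T generalizing b with
  | output x => simp [truncate]
  | query U next ih =>
    cases b with
    | zero => simp [numQueries] at h
    | succ b => simpa [truncate, eval] using ih _ b (by simpa [numQueries] using h)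

theorem eval_truncate_of_lt (r : ℝ) (G : SimpleGraph (Fin n)) (b : ℕ) (T : ISDecisionTree n)
    (h : b < T.numQueries G) : (T.truncate r b).eval G = r := by
  induction T generalizing b with
  | output x => simp [numQueries] at h
  | query U next ih =>
    cases b with
    | zero => simp [truncate, eval]
    | succ b => simpa [truncate, eval] using ih _ b (by simpa [numQueries] using h)

end ISDecisionTree

/-! ### A calculus of deterministic computations with query costs. -/

/-- On the graphs in `S`, the value `f G` can be found deterministically with at most `q G`
independent set queries, after which any other algorithm may be run that uses this value. -/
def ISComputable {n : ℕ} {α : Type*} (S : Set (SimpleGraph (Fin n)))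
    (f : SimpleGraph (Fin n) → α) (q : SimpleGraph (Fin n) → ℕ) : Prop :=
  ∀ k : α → ISDecisionTree n, ∃ T : ISDecisionTree n, ∀ G ∈ S,
    T.eval G = (k (f G)).eval G ∧ T.numQueries G ≤ q G + (k (f G)).numQueries G

namespace ISComputable

variable {n : ℕ} {α β : Type*} {S S' : Set (SimpleGraph (Fin n))}
  {f f' : SimpleGraph (Fin n) → α} {q q' : SimpleGraph (Fin n) → ℕ}

theorem mono (h : ISComputable S f q) (hS : S' ⊆ S) (hf : ∀ G ∈ S', f G = f' G)
    (hq : ∀ G ∈ S', q G ≤ q' G) : ISComputable S' f' q' := by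
  intro k
  obtain ⟨T, hT⟩ := h k
  refine ⟨T, fun G hG => ?_⟩
  rw [← hf G hG]
  exact ⟨(hT G (hS hG)).1, (hT G (hS hG)).2.trans (by gcongr; exact hq G hG)⟩

theorem const (a : α) : ISComputable S (fun _ => a) (fun _ => 0) :=
  fun k => ⟨k a, fun _ _ => ⟨rfl, by simp⟩⟩

/-- The second computation is chosen after `f G` is known, so for each value `a` it need only be
correct on the graphs with `f G = a`. This is how information gained by earlier queries is passed
on. -/
theorem bind {g : α → SimpleGraph (Fin n) → β} {r : α → SimpleGraph (Fin n) → ℕ}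
    (hf : ISComputable S f q)
    (hg : ∀ a, ISComputable {G | G ∈ S ∧ f G = a} (g a) (r a)) :
    ISComputable S (fun G => g (f G) G) (fun G => q G + r (f G) G) := by
  intro k
  choose t ht using fun a => hg a k
  obtain ⟨T, hT⟩ := hf t
  refine ⟨T, fun G hG => ?_⟩
  have h1 := hT G hG
  have h2 := ht (f G) G ⟨hG, rfl⟩
  exact ⟨h1.1.trans h2.1, by linarith [h1.2, h2.2]⟩

theorem map (hf : ISComputable S f q) (g : α → β) : ISComputable S (fun G => g (f G)) q :=
  (hf.bind fun a => const (g a)).mono subset_rfl (fun _ _ => rfl) (fun _ _ => le_rfl)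

theorem add {f f' : SimpleGraph (Fin n) → ℕ} (h : ISComputable S f q)
    (h' : ISComputable S f' q') :
    ISComputable S (fun G => f G + f' G) (fun G => q G + q' G) :=
  h.bind (g := fun a G => a + f' G) (r := fun _ => q')
    fun a => (h'.map (a + ·)).mono (fun _ h => h.1) (fun _ _ => rfl) (fun _ _ => le_rfl)

theorem sum {ι : Type*} (s : Finset ι) {f : ι → SimpleGraph (Fin n) → ℕ}
    {q : ι → SimpleGraph (Fin n) → ℕ} (h : ∀ i ∈ s, ISComputable S (f i) (q i)) :
    ISComputable S (fun G => ∑ i ∈ s, f i G) (fun G => ∑ i ∈ s, q i G) := by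
  classical
  induction s using Finset.induction_on with
  | empty => simpa using const 0
  | insert i s hi ih =>
    simp only [Finset.sum_insert hi]
    exact (h i (by simp)).add (ih fun j hj => h j (by simp [hj]))

theorem pi {ι : Type*} [Fintype ι] [Zero α] {f : ι → SimpleGraph (Fin n) → α}
    {q : ι → SimpleGraph (Fin n) → ℕ} (h : ∀ i, ISComputable S (f i) (q i)) :
    ISComputable S (fun G i => f i G) (fun G => ∑ i, q i G) := by
  classical
  suffices H : ∀ s : Finset ι, ISComputable S (fun G i => if i ∈ s then f i G else 0)
      (fun G => ∑ i ∈ s, q i G) by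
    simpa using H Finset.univ
  intro s
  induction s using Finset.induction_on with
  | empty => exact (const (0 : ι → α)).mono subset_rfl (fun _ _ => by funext; simp) (by simp)
  | insert i s hi ih =>
    refine ((h i).bind (g := fun a G => Function.update (fun j => if j ∈ s then f j G else 0) i a)
      (r := fun _ G => ∑ i ∈ s, q i G)
      fun a => (ih.map fun v => Function.update v i a).mono (fun _ h => h.1) (fun _ _ => rfl)
        (fun _ _ => le_rfl)).mono subset_rfl ?_ ?_
    · intro G _
      funext j
      by_cases hj : j = i
      · subst hj; simp
      · simp [hj]
    · intro G _
      simp [Finset.sum_insert hi]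

/-- Ask whether `U` is independent, and go on separately in the two cases. -/
theorem query (U : Finset (Fin n))
    (h : ISComputable {G | G ∈ S ∧ G.IsIndepSet (U : Set (Fin n))} f q)
    (h' : ISComputable {G | G ∈ S ∧ ¬ G.IsIndepSet (U : Set (Fin n))} f q) :
    ISComputable S f (fun G => 1 + q G) := by
  intro k
  obtain ⟨T, hT⟩ := h k
  obtain ⟨T', hT'⟩ := h' k
  refine ⟨.query U fun b => if b then T else T', fun G hG => ?_⟩
  by_cases hU : G.IsIndepSet (U : Set (Fin n))
  · have := hT G ⟨hG, hU⟩
    simp only [ISDecisionTree.eval, ISDecisionTree.numQueries, isOracle, hU, decide_true, if_true]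
    exact ⟨this.1, by linarith [this.2]⟩
  · have := hT' G ⟨hG, hU⟩
    simp only [ISDecisionTree.eval, ISDecisionTree.numQueries, isOracle, hU, decide_false,
      Bool.false_eq_true, if_false]
    exact ⟨this.1, by linarith [this.2]⟩

/-- Turns a cost depending on `G` into a worst-case budget `b`. The default `r` can appear in place
of `f G` only if the cost bound exceeds the budget. -/
theorem exists_truncate {f : SimpleGraph (Fin n) → ℝ} (h : ISComputable S f q) (r : ℝ) (b : ℕ) :
    ∃ f' : SimpleGraph (Fin n) → ℝ, ISComputable Set.univ f' (fun _ => b) ∧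
      ∀ G ∈ S, f' G = f G ∨ f' G = r ∧ b < q G := by
  obtain ⟨T, hT⟩ := h .output
  refine ⟨(T.truncate r b).eval, fun k => ⟨(T.truncate r b).bind k, fun G _ => ⟨?_, ?_⟩⟩, ?_⟩
  · exact ISDecisionTree.eval_bind _ _ _
  · rw [ISDecisionTree.numQueries_bind]
    gcongr
    exact ISDecisionTree.numQueries_truncate_le _ _ _ _
  · intro G hG
    have h1 := hT G hG
    simp only [ISDecisionTree.eval, ISDecisionTree.numQueries, add_zero] at h1
    rcases le_or_gt (T.numQueries G) b with hb | hb
    · left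
      exact (ISDecisionTree.eval_truncate_of_le _ _ _ _ hb).trans h1.1
    · right
      exact ⟨ISDecisionTree.eval_truncate_of_lt _ _ _ _ hb, by omega⟩

end ISComputable

/-! ### Exact edge counting by halving and group testing. -/

section EdgeCount

variable {n : ℕ}

open Classical in
/-- The number of neighbours of `v` in `W`. -/
noncomputable def nbrCount (G : SimpleGraph (Fin n)) (v : Fin n) (W : Finset (Fin n)) : ℕ :=
  (W.filter fun u => G.Adj v u).card

open Classical in
/-- The number of ordered pairs of adjacent vertices in `U`, twice the number of edges in `U`. -/
noncomputable def adjCount (G : SimpleGraph (Fin n)) (U : Finset (Fin n)) : ℕ :=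
  ((U ×ˢ U).filter fun p => G.Adj p.1 p.2).card

theorem adjCount_eq_sum (G : SimpleGraph (Fin n)) (U : Finset (Fin n)) :
    adjCount G U = ∑ v ∈ U, nbrCount G v U := by
  classical
  simp only [adjCount, nbrCount, Finset.card_filter, Finset.sum_product]

theorem nbrCount_union (G : SimpleGraph (Fin n)) (v : Fin n) {W W' : Finset (Fin n)}
    (h : Disjoint W W') : nbrCount G v (W ∪ W') = nbrCount G v W + nbrCount G v W' := by
  classical
  simp only [nbrCount, Finset.card_filter, Finset.sum_union h]

theorem sum_nbrCount_comm (G : SimpleGraph (Fin n)) (W W' : Finset (Fin n)) :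
    ∑ v ∈ W, nbrCount G v W' = ∑ v ∈ W', nbrCount G v W := by
  classical
  simp only [nbrCount, Finset.card_filter]
  rw [Finset.sum_comm]
  simp only [G.adj_comm]

theorem nbrCount_eq_zero_of_isIndepSet {G : SimpleGraph (Fin n)} {v : Fin n}
    {W : Finset (Fin n)} (h : G.IsIndepSet (insert v W : Set (Fin n))) : nbrCount G v W = 0 := by
  classical
  rw [nbrCount, Finset.card_eq_zero, Finset.filter_eq_empty_iff]
  intro u hu huv
  exact h (by simp) (by simp [hu]) huv.ne huv

theorem adjCount_eq_zero_of_isIndepSet {G : SimpleGraph (Fin n)}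
    {U : Finset (Fin n)} (h : G.IsIndepSet (U : Set (Fin n))) : adjCount G U = 0 := by
  rw [adjCount_eq_sum]
  refine Finset.sum_eq_zero fun v hv => nbrCount_eq_zero_of_isIndepSet ?_
  rwa [Set.insert_eq_of_mem (by simpa using hv)]

theorem one_le_nbrCount {G : SimpleGraph (Fin n)} {u v : Fin n} {W : Finset (Fin n)} (hu : u ∈ W)
    (h : G.Adj v u) : 1 ≤ nbrCount G v W := by
  classical
  exact Finset.card_pos.2 ⟨u, by simp [hu, h]⟩

theorem exists_adj_of_not_isIndepSet_insert {G : SimpleGraph (Fin n)} {v : Fin n}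
    {W : Set (Fin n)} (hW : G.IsIndepSet W)
    (h : ¬ G.IsIndepSet (insert v W)) : ∃ u ∈ W, G.Adj v u := by
  contrapose! h
  rw [SimpleGraph.IsIndepSet, Set.pairwise_insert]
  exact ⟨hW, fun u hu _ => ⟨h u hu, fun h' => h u hu h'.symm⟩⟩

theorem exists_halving {d : ℕ} {W : Finset (Fin n)} (h : W.card ≤ 2 ^ (d + 1)) :
    ∃ A B : Finset (Fin n), W = A ∪ B ∧ Disjoint A B ∧ A.card ≤ 2 ^ d ∧ B.card ≤ 2 ^ d := by
  obtain ⟨A, hA, hc⟩ := Finset.exists_subset_card_eq (s := W) (n := min W.card (2 ^ d)) (by simp)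
  refine ⟨A, W \ A, by simp [hA], Finset.disjoint_sdiff, by simp [hc], ?_⟩
  rw [Finset.card_sdiff_of_subset hA, hc]
  omega

/-- Group testing for the neighbours of a vertex in an independent set. -/
theorem isComputable_nbrCount (v : Fin n) (d : ℕ) (W : Finset (Fin n)) (hW : W.card ≤ 2 ^ d) :
    ISComputable {G | G.IsIndepSet (W : Set (Fin n))} (fun G => nbrCount G v W)
      (fun G => 1 + 2 * d * nbrCount G v W) := by
  classical
  induction d generalizing W with
  | zero =>
    refine ISComputable.query (insert v W) (ISComputable.mono (.const 0) subset_rfl ?_ (by simp))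
      -- Here `W` has at most one vertex, so a negative answer forces every vertex of `W` to be a
      -- neighbour.
      (ISComputable.mono (.const W.card) subset_rfl ?_ (by simp))
    · rintro G ⟨_, hG⟩
      rw [nbrCount_eq_zero_of_isIndepSet (by simpa using hG)]
    · rintro G ⟨hG, hG'⟩
      obtain ⟨u, hu, huv⟩ := exists_adj_of_not_isIndepSet_insert hG (by simpa using hG')
      have h1 := one_le_nbrCount hu huv
      have h2 : nbrCount G v W ≤ W.card := Finset.card_filter_le _ _
      simp at hW
      omega
  | succ d ih =>
    refine ISComputable.query (insert v W) (ISComputable.mono (.const 0) subset_rfl ?_ (by simp)) ?_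
    · rintro G ⟨_, hG⟩
      rw [nbrCount_eq_zero_of_isIndepSet (by simpa using hG)]
    · obtain ⟨A, B, rfl, hAB, hA, hB⟩ := exists_halving hW
      refine ISComputable.mono (S := {G | G.IsIndepSet ((A ∪ B : Finset _) : Set (Fin n)) ∧
        ¬ G.IsIndepSet (insert v (A ∪ B) : Finset _)})
        (((ih A hA).mono (S' := _) ?_ (fun _ _ => rfl) (fun _ _ => le_rfl)).add
        ((ih B hB).mono ?_ (fun _ _ => rfl) (fun _ _ => le_rfl))) (fun G hG => hG) ?_ ?_
      · rintro G ⟨hG, -⟩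
        exact hG.mono (by simp)
      · rintro G ⟨hG, -⟩
        exact hG.mono (by simp)
      · intro G _
        rw [nbrCount_union _ _ hAB]
      · rintro G ⟨hG, hG'⟩
        obtain ⟨u, hu, huv⟩ := exists_adj_of_not_isIndepSet_insert hG (by simpa using hG')
        -- A failed query certifies at least one neighbour, which pays for the two extra units `1 +
        -- 1` of the recursive calls.
        have h1 := one_le_nbrCount hu huv
        rw [nbrCount_union _ _ hAB] at h1 ⊢
        nlinarith

/-- A maximal way of enlarging an independent set inside `W`, found by halving. The set `R`
consists of the vertices that are left out. -/
theorem exists_isComputable_maximal_indep (d : ℕ) (W I : Finset (Fin n)) (hW : W.card ≤ 2 ^ d) :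
    ∃ R : SimpleGraph (Fin n) → Finset (Fin n),
      ISComputable {G | G.IsIndepSet (I : Set (Fin n))} R (fun G => 1 + 2 * d * (R G).card) ∧
      ∀ G : SimpleGraph (Fin n), G.IsIndepSet (I : Set (Fin n)) →
        R G ⊆ W ∧ G.IsIndepSet ((I ∪ (W \ R G) : Finset (Fin n)) : Set (Fin n)) ∧
        ∀ v ∈ R G, ∃ u ∈ I ∪ (W \ R G), G.Adj v u := by
  classical
  induction d generalizing W I with
  | zero =>
    refine ⟨fun G => if G.IsIndepSet ((I ∪ W : Finset _) : Set (Fin n)) then ∅ else W,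
      ISComputable.query (I ∪ W) (ISComputable.mono (.const ∅) subset_rfl ?_ (by simp))
      (ISComputable.mono (.const W) subset_rfl ?_ (by simp)), ?_⟩
    · rintro G ⟨_, hG⟩
      rw [if_pos hG]
    · rintro G ⟨_, hG⟩
      rw [if_neg hG]
    · intro G hI
      by_cases h : G.IsIndepSet ((I ∪ W : Finset _) : Set (Fin n))
      · simp only [if_pos h]
        simpa using h
      · simp only [if_neg h]
        refine ⟨subset_rfl, by simpa using hI, ?_⟩
        intro v hv
        have hWv : W = {v} := by
          have := Finset.card_le_one.1 (by simpa using hW)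
          ext u
          simp only [Finset.mem_singleton]
          exact ⟨fun hu => this u hu v hv, fun hu => hu ▸ hv⟩
        subst hWv
        obtain ⟨u, hu, huv⟩ := exists_adj_of_not_isIndepSet_insert (v := v) hI (by simpa using h)
        exact ⟨u, by simpa using hu, huv⟩
  | succ d ih =>
    obtain ⟨A, B, rfl, hAB, hA, hB⟩ := exists_halving hW
    obtain ⟨R₁, hR₁, h₁⟩ := ih A I hA
    -- The second half is tested together with the vertices kept from the first; `X` ranges over the
    -- possible left-out sets of that half.
    choose R₂ hR₂ h₂ using fun X : Finset (Fin n) => ih B (I ∪ (A \ X)) hB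
    set R : SimpleGraph (Fin n) → Finset (Fin n) :=
      fun G => if G.IsIndepSet ((I ∪ (A ∪ B) : Finset _) : Set (Fin n)) then ∅
        else R₁ G ∪ R₂ (R₁ G) G with hRdef
    have hdisj : ∀ G, G.IsIndepSet (I : Set (Fin n)) →
        Disjoint (R₁ G) (R₂ (R₁ G) G) ∧
        I ∪ ((A ∪ B) \ (R₁ G ∪ R₂ (R₁ G) G)) = (I ∪ (A \ R₁ G)) ∪ (B \ R₂ (R₁ G) G) := by
      intro G hG
      have h3 := h₁ G hG
      have h4 := h₂ (R₁ G) G h3.2.1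
      have hd : ∀ x, x ∈ A → x ∈ B → False := fun x h h' => Finset.disjoint_left.1 hAB h h'
      refine ⟨Finset.disjoint_left.2 fun x hx hx' => hd x (h3.1 hx) (h4.1 hx'), ?_⟩
      ext x
      have h5 := hd x
      have h6 := @h3.1 x
      have h7 := @h4.1 x
      simp only [Finset.mem_union, Finset.mem_sdiff]
      tauto
    refine ⟨R, ISComputable.query (I ∪ (A ∪ B))
      (ISComputable.mono (.const ∅) subset_rfl ?_ (by simp)) ?_, ?_⟩
    · rintro G ⟨_, hG⟩
      simp only [hRdef, if_pos hG]
    · refine ISComputable.mono (S := {G | G.IsIndepSet (I : Set (Fin n)) ∧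
        ¬ G.IsIndepSet ((I ∪ (A ∪ B) : Finset _) : Set (Fin n))})
        ((hR₁.mono (fun G hG => hG.1) (fun _ _ => rfl) (fun _ _ => le_rfl)).bind
        (g := fun X G => X ∪ R₂ X G)
        (r := fun X G => 1 + 2 * d * (R₂ X G).card) fun X =>
          ((hR₂ X).map (X ∪ ·)).mono ?_ (fun _ _ => rfl) (fun _ _ => le_rfl))
        (fun G hG => hG) ?_ ?_
      · rintro G ⟨hG, rfl⟩
        exact (h₁ G hG.1).2.1
      · rintro G ⟨-, hG⟩
        simp only [hRdef, if_neg hG]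
      · rintro G ⟨hI, hG⟩
        simp only [hRdef, if_neg hG]
        obtain ⟨h5, h6⟩ := hdisj G hI
        have h4 := (h₂ (R₁ G) G (h₁ G hI).2.1).2.1
        rw [← h6] at h4
        rw [Finset.card_union_of_disjoint h5]
        -- If nothing were left out, the whole set would be independent, contrary to the answer. So
        -- some left-out vertex pays for the split.
        have : 1 ≤ (R₁ G).card + (R₂ (R₁ G) G).card := by
          rw [← Finset.card_union_of_disjoint h5, Nat.one_le_iff_ne_zero, Ne, Finset.card_eq_zero]
          intro h0
          rw [h0] at h4
          exact hG (by simpa using h4)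
        nlinarith
    · intro G hI
      by_cases h : G.IsIndepSet ((I ∪ (A ∪ B) : Finset _) : Set (Fin n))
      · simp only [hRdef, if_pos h]
        simpa using h
      · simp only [hRdef, if_neg h]
        obtain ⟨h5, h6⟩ := hdisj G hI
        have h3 := h₁ G hI
        have h4 := h₂ (R₁ G) G h3.2.1
        rw [h6]
        refine ⟨Finset.union_subset_union h3.1 h4.1, h4.2.1, fun v hv => ?_⟩
        rcases Finset.mem_union.1 hv with hv | hv
        · obtain ⟨u, hu, huv⟩ := h3.2.2 v hv
          exact ⟨u, Finset.mem_union_left _ hu, huv⟩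
        · exact h4.2.2 v hv

/-- No pair lies inside `U \ R`, and each edge between `R` and `U \ R` gives two ordered pairs. -/
theorem adjCount_eq_of_isIndepSet_sdiff {G : SimpleGraph (Fin n)} {U R : Finset (Fin n)}
    (hR : R ⊆ U) (h : G.IsIndepSet ((U \ R : Finset (Fin n)) : Set (Fin n))) :
    adjCount G U = 2 * ∑ v ∈ R, nbrCount G v (U \ R) + adjCount G R := by
  have h0 := adjCount_eq_zero_of_isIndepSet h
  rw [adjCount_eq_sum] at h0 ⊢
  have h1 : ∀ v, nbrCount G v U = nbrCount G v (U \ R) + nbrCount G v R := fun v => by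
    rw [← nbrCount_union _ _ Finset.sdiff_disjoint, Finset.sdiff_union_of_subset hR]
  rw [← Finset.sum_sdiff hR, adjCount_eq_sum]
  simp only [h1, Finset.sum_add_distrib, h0]
  rw [sum_nbrCount_comm G (U \ R) R]
  ring

/-- All edges inside `U` can be counted with `O(log n)` queries per edge. -/
theorem isComputable_adjCount {d : ℕ} (hd : 1 ≤ d) (U : Finset (Fin n)) (hU : U.card ≤ 2 ^ d) :
    ISComputable Set.univ (fun G => adjCount G U) (fun G => 1 + 3 * d * adjCount G U) := by
  classical
  induction U using Finset.strongInduction with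
  | H U ih =>
  obtain ⟨R, hR, h⟩ := exists_isComputable_maximal_indep d U ∅ hU
  have hind : ∀ G : SimpleGraph (Fin n), G.IsIndepSet ((∅ : Finset (Fin n)) : Set (Fin n)) := by
    intro G; simp [SimpleGraph.IsIndepSet]
  simp only [hind, Set.ofPred_true, forall_const, Finset.empty_union] at hR h
  have hsum : ∀ G, (R G).card ≤ ∑ v ∈ R G, nbrCount G v (U \ R G) := by
    intro G
    rw [Finset.card_eq_sum_ones]
    refine Finset.sum_le_sum fun v hv => ?_
    obtain ⟨u, hu, huv⟩ := (h G).2.2 v hv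
    exact one_le_nbrCount hu huv
  refine ISComputable.mono (S := Set.univ) (hR.bind
    (g := fun X G => if X = ∅ then 0 else
      2 * ∑ v ∈ X, nbrCount G v (U \ X) + adjCount G X)
    (r := fun X G => if X = ∅ then 0 else
      ∑ v ∈ X, (1 + 2 * d * nbrCount G v (U \ X)) + (1 + 3 * d * adjCount G X)) fun X => ?_)
    (fun G hG => hG) ?_ ?_
  · by_cases hX : X = ∅
    · simpa [hX] using ISComputable.const 0
    · simp only [hX, if_false]
      by_cases hXU : X ⊂ U
      · refine ISComputable.add (((ISComputable.sum X fun v _ =>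
          (isComputable_nbrCount v d (U \ X) ?_)).map (2 * ·)).mono ?_ (fun _ _ => rfl)
            (fun _ _ => le_rfl))
          ((ih X hXU ?_).mono (by simp) (fun _ _ => rfl) (fun _ _ => le_rfl))
        · exact (Finset.card_le_card Finset.sdiff_subset).trans hU
        · rintro G ⟨-, rfl⟩
          exact (h G).2.1
        · exact (Finset.card_le_card hXU.1).trans hU
      -- Here `X` is nonempty and not a proper subset of `U`. This value never occurs: if all of `U`
      -- were left out, a left-out vertex would have no kept neighbour.
      · have hne : ∀ G : SimpleGraph (Fin n), ¬ (G ∈ Set.univ ∧ R G = X) := by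
          rintro G ⟨-, rfl⟩
          have : R G = U := by
            by_contra hne
            exact hXU ((h G).1.ssubset_of_ne hne)
          obtain ⟨v, hv⟩ := Finset.nonempty_iff_ne_empty.2 hX
          obtain ⟨u, hu, -⟩ := (h G).2.2 v hv
          simp [this] at hu
        refine ISComputable.mono (S := ∅) (f := fun _ => 0) (q := fun _ => 0) (.const 0) ?_
          (fun G hG => (hne G hG).elim) (fun G hG => (hne G hG).elim)
        exact fun G hG => hne G hG
  · intro G _
    have := adjCount_eq_of_isIndepSet_sdiff (h G).1 (h G).2.1
    split_ifs with h0
    · rw [this]; simp [h0, adjCount]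
    · exact this.symm
  · intro G _
    have h1 := adjCount_eq_of_isIndepSet_sdiff (h G).1 (h G).2.1
    have h2 := hsum G
    split_ifs with h0
    · simp [h0]
    · have h3 : 1 ≤ (R G).card := Finset.card_pos.2 (Finset.nonempty_iff_ne_empty.2 h0)
      rw [h1, Finset.sum_add_distrib, ← Finset.mul_sum, ← Finset.card_eq_sum_ones]
      generalize ∑ v ∈ R G, nbrCount G v (U \ R G) = D at *
      -- The constant `3` comes from `2d|R| + |R| + 2dD + 1 ≤ 6dD`, using `1 ≤ |R| ≤ D`; the `D`
      -- crossing edges contribute `2D` to `adjCount G U`.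
      have h4 : d * (R G).card ≤ d * D := Nat.mul_le_mul_left _ h2
      have h5 : 1 * D ≤ d * D := Nat.mul_le_mul_right _ hd
      have h6 : (R G).card * 1 ≤ D * d := Nat.mul_le_mul h2 hd
      nlinarith

end EdgeCount

/-! ### Medians and amplification of the success probability. -/

section Probability

open MeasureTheory ProbabilityTheory

/-- If more than half of the numbers `v i` lie in an interval, so does the median. -/
theorem exists_median {g : ℕ} (v : Fin g → ℝ) : ∃ x : ℝ, ∀ a b : ℝ,
    g < 2 * (Finset.univ.filter fun i => a ≤ v i ∧ v i ≤ b).card → a ≤ x ∧ x ≤ b := by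
  classical
  -- The median is the least value with more than half of all values at or below it.
  set S := Finset.univ.filter fun i => g < 2 * (Finset.univ.filter fun k => v k ≤ v i).card
    with hS
  have key : ∀ a b : ℝ, g < 2 * (Finset.univ.filter fun i => a ≤ v i ∧ v i ≤ b).card →
      ∃ i ∈ S, v i ≤ b := by
    intro a b h
    obtain ⟨i, hi, hmax⟩ := Finset.exists_max_image
      (Finset.univ.filter fun i => a ≤ v i ∧ v i ≤ b) v (Finset.card_pos.1 (by omega))
    refine ⟨i, ?_, (Finset.mem_filter.1 hi).2.2⟩
    simp only [hS, Finset.mem_filter, Finset.mem_univ, true_and]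
    refine h.trans_le (Nat.mul_le_mul_left _ (Finset.card_le_card fun k hk => ?_))
    simpa using hmax k hk
  rcases S.eq_empty_or_nonempty with hemp | hne
  · exact ⟨0, fun a b h => by obtain ⟨i, hi, -⟩ := key a b h; simp [hemp] at hi⟩
  obtain ⟨i, hi, hmin⟩ := Finset.exists_min_image S v hne
  refine ⟨v i, fun a b h => ⟨?_, ?_⟩⟩
  -- Otherwise the values in `[a, b]` and those at most `v i` would be two disjoint majorities.
  · by_contra! hlt
    have h1 : g < 2 * (Finset.univ.filter fun k => v k ≤ v i).card := by simpa [hS] using hi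
    have h2 : Disjoint (Finset.univ.filter fun i => a ≤ v i ∧ v i ≤ b)
        (Finset.univ.filter fun k => v k ≤ v i) := by
      rw [Finset.disjoint_filter]
      intro k _ hk hk'
      linarith [hk.1]
    have h3 := Finset.card_le_univ ((Finset.univ.filter fun i => a ≤ v i ∧ v i ≤ b) ∪
        (Finset.univ.filter fun k => v k ≤ v i))
    rw [Finset.card_union_of_disjoint h2, Fintype.card_fin] at h3
    omega
  · obtain ⟨k, hk, hkb⟩ := key a b h
    exact (hmin k hk).trans hkb

/-- A median of finitely many numbers. -/
noncomputable def median {g : ℕ} (v : Fin g → ℝ) : ℝ := (exists_median v).choose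

theorem median_mem {g : ℕ} (v : Fin g → ℝ) {a b : ℝ}
    (h : g < 2 * (Finset.univ.filter fun i => a ≤ v i ∧ v i ≤ b).card) :
    a ≤ median v ∧ median v ≤ b :=
  (exists_median v).choose_spec a b h

section Boost

variable {Ω : Type*} [MeasurableSpace Ω] [DiscreteMeasurableSpace Ω] [Finite Ω]
  (μ : Measure Ω) [IsProbabilityMeasure μ]

-- An exponential Markov bound: `16 ^ #bad` has mean `(1 + 15 μ(B)) ^ g ≤ 2 ^ g`, while it is at
-- least `4 ^ g` when half of the trials are bad.
open Classical in
theorem measureReal_pi_half_bad_le (g : ℕ) {B : Set Ω} (hB : μ.real B ≤ 1 / 15) :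
    (Measure.pi fun _ : Fin g => μ).real
      {ω | g ≤ 2 * (Finset.univ.filter fun i => ω i ∈ B).card} ≤ (1 / 2) ^ g := by
  set P := Measure.pi fun _ : Fin g => μ
  set F : (Fin g → Ω) → ℝ := fun ω => ∏ i, (if ω i ∈ B then 16 else 1) with hF
  have hval : ∀ ω, F ω = 16 ^ (Finset.univ.filter fun i => ω i ∈ B).card := by
    intro ω
    simp [hF, Finset.prod_ite]
  have hint1 : ∫ x, (if x ∈ B then (16 : ℝ) else 1) ∂μ = 1 + 15 * μ.real B := by
    have : (fun x => if x ∈ B then (16 : ℝ) else 1) =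
        fun x => 1 + 15 * B.indicator (fun _ => (1 : ℝ)) x := by
      funext x
      by_cases h : x ∈ B <;> simp [h]; norm_num
    rw [this, integral_add Integrable.of_finite Integrable.of_finite, integral_const_mul,
      integral_indicator (MeasurableSet.of_discrete)]
    simp
  have hint : ∫ ω, F ω ∂P ≤ 2 ^ g := by
    rw [integral_fintype_prod_eq_prod (fun _ : Fin g => fun x => if x ∈ B then (16 : ℝ) else 1)]
    simp only [hint1, Finset.prod_const, Finset.card_univ, Fintype.card_fin]
    gcongr
    linarith
  have hmarkov := mul_meas_ge_le_integral_of_nonneg (μ := P) (f := F)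
    (Filter.Eventually.of_forall fun ω => by simp only [hval]; positivity)
    Integrable.of_finite (4 ^ g)
  have hsub : P.real {ω | g ≤ 2 * (Finset.univ.filter fun i => ω i ∈ B).card}
      ≤ P.real {ω | (4 : ℝ) ^ g ≤ F ω} := by
    refine measureReal_mono fun ω hω => ?_
    simp only [Set.mem_ofPred_eq, hval] at hω ⊢
    calc (4 : ℝ) ^ g ≤ 4 ^ (2 * (Finset.univ.filter fun i => ω i ∈ B).card) :=
          pow_le_pow_right₀ (by norm_num) hω
      _ = _ := by rw [pow_mul]; norm_num
  have h4 : (4 : ℝ) ^ g = 2 ^ g * 2 ^ g := by rw [← mul_pow]; norm_num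
  have h2 : (0 : ℝ) < 2 ^ g := by positivity
  have : (4 : ℝ) ^ g * P.real {ω | g ≤ 2 * (Finset.univ.filter fun i => ω i ∈ B).card}
      ≤ 2 ^ g := (mul_le_mul_of_nonneg_left hsub (by positivity)).trans (hmarkov.trans hint)
  rw [one_div, inv_pow, ← one_div, le_div_iff₀ h2]
  rw [h4, mul_assoc] at this
  have := le_of_mul_le_mul_left (this.trans_eq (mul_one _).symm) h2
  linarith

end Boost

/-! ### Mean and variance of the edge count in a random vertex set. -/

section RandomSubset

variable {n : ℕ}

/-- The law of a random subset of `Fin n` that contains each element independently with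
probability `p`. -/
noncomputable abbrev randomSubset (n : ℕ) (p : unitInterval) : Measure (Fin n → Bool) :=
  Measure.pi fun _ => bernoulliMeasure true false p

/-- The subset with indicator function `ω`. -/
def chosen (ω : Fin n → Bool) : Finset (Fin n) := Finset.univ.filter fun v => ω v = true

open Classical in
theorem integral_subset_chosen (p : unitInterval) (s : Finset (Fin n)) :
    ∫ ω, (if s ⊆ chosen ω then (1 : ℝ) else 0) ∂(randomSubset n p) = (p : ℝ) ^ s.card := by
  have h1 : ∀ ω : Fin n → Bool, (if s ⊆ chosen ω then (1 : ℝ) else 0) =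
      ∏ v, (if v ∈ s → ω v = true then (1 : ℝ) else 0) := by
    intro ω
    rw [Finset.prod_ite_zero]
    simp [Finset.subset_iff, chosen]
  simp only [h1]
  rw [integral_fintype_prod_eq_prod
    (fun v : Fin n => fun b : Bool => if v ∈ s → b = true then (1 : ℝ) else 0)]
  have h2 : ∀ v : Fin n, ∫ b : Bool, (if v ∈ s → b = true then (1 : ℝ) else 0)
      ∂(bernoulliMeasure true false p) = if v ∈ s then (p : ℝ) else 1 := by
    intro v
    by_cases h : v ∈ s
    · simp [h, integral_bernoulliMeasure]
    · simp [h]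
  simp only [h2]
  simp

open Classical in
/-- The ordered pairs of adjacent vertices. -/
noncomputable def adjPairs (G : SimpleGraph (Fin n)) : Finset (Fin n × Fin n) :=
  Finset.univ.filter fun q => G.Adj q.1 q.2

open Classical in
theorem adjCount_chosen (G : SimpleGraph (Fin n)) (ω : Fin n → Bool) :
    (adjCount G (chosen ω) : ℝ) =
      ∑ q ∈ adjPairs G, if ({q.1, q.2} : Finset (Fin n)) ⊆ chosen ω then (1 : ℝ) else 0 := by
  rw [Finset.sum_boole, adjCount, adjPairs, Finset.filter_filter]
  congr 2
  ext q
  simp [Finset.insert_subset_iff, and_comm]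

theorem adjCount_univ (G : SimpleGraph (Fin n)) :
    adjCount G Finset.univ = (adjPairs G).card := by
  simp [adjCount, adjPairs]

theorem card_adjPairs (G : SimpleGraph (Fin n)) :
    (adjPairs G).card = 2 * G.edgeSet.ncard := by
  classical
  rw [← adjCount_univ, adjCount_eq_sum, ← SimpleGraph.coe_edgeFinset, Set.ncard_coe_finset,
    ← SimpleGraph.sum_degrees_eq_twice_card_edges]
  refine Finset.sum_congr rfl fun v _ => ?_
  simp only [nbrCount, ← SimpleGraph.card_neighborFinset_eq_degree]
  congr 1
  ext u
  simp

theorem integral_adjCount (p : unitInterval) (G : SimpleGraph (Fin n)) :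
    ∫ ω, (adjCount G (chosen ω) : ℝ) ∂(randomSubset n p) = (adjPairs G).card * (p : ℝ) ^ 2 := by
  classical
  simp only [adjCount_chosen]
  rw [integral_finsetSum _ fun _ _ => Integrable.of_finite]
  simp only [integral_subset_chosen]
  rw [← nsmul_eq_mul]
  refine Finset.sum_eq_card_nsmul fun q hq => ?_
  rw [Finset.card_pair]
  exact (Finset.mem_filter.1 hq).2.ne

-- The exponent is `4`, `3` or `2` according to how many vertices the pairs share. Writing the cases
-- as sums of indicators lets each be summed separately over all pairs.
open Classical in
theorem pow_card_pair_union_le (p : unitInterval) {a b x y : Fin n} (hab : a ≠ b) (hxy : x ≠ y) :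
    (p : ℝ) ^ (({a, b} ∪ {x, y} : Finset (Fin n))).card ≤ (p : ℝ) ^ 4 +
      (p : ℝ) ^ 3 * ((if x = a then 1 else 0) + (if x = b then 1 else 0) +
        (if y = a then 1 else 0) + (if y = b then 1 else 0)) +
      (p : ℝ) ^ 2 * ((if (x, y) = (a, b) then 1 else 0) + (if (x, y) = (b, a) then 1 else 0)) := by
  have hp0 : (0 : ℝ) ≤ p := p.2.1
  have hp1 : (p : ℝ) ≤ 1 := p.2.2
  have hmono : ∀ s t : Finset (Fin n), s ⊆ t → (p : ℝ) ^ t.card ≤ (p : ℝ) ^ s.card :=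
    fun s t h => pow_le_pow_of_le_one hp0 hp1 (Finset.card_le_card h)
  have h2 : (0 : ℝ) ≤ (p : ℝ) ^ 2 := by positivity
  have h3 : (0 : ℝ) ≤ (p : ℝ) ^ 3 := by positivity
  have h4 : (0 : ℝ) ≤ (p : ℝ) ^ 4 := by positivity
  by_cases hx : x = a ∨ x = b
  · by_cases hy : y = a ∨ y = b
    · have := hmono {a, b} ({a, b} ∪ {x, y}) Finset.subset_union_left
      rw [Finset.card_pair hab] at this
      have hge : (1 : ℝ) ≤ (if (x, y) = (a, b) then 1 else 0) +
          (if (x, y) = (b, a) then 1 else 0) := by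
        rcases hx with rfl | rfl <;> rcases hy with rfl | rfl <;> simp_all
      have h5 : (0 : ℝ) ≤ (if x = a then 1 else 0) + (if x = b then 1 else 0) +
        (if y = a then 1 else 0) + (if y = b then 1 else 0) := by positivity
      nlinarith [mul_nonneg h3 h5, mul_le_mul_of_nonneg_left hge h2]
    · have : (p : ℝ) ^ ({a, b} ∪ {x, y} : Finset (Fin n)).card ≤ (p : ℝ) ^ 3 := by
        have := hmono {y, a, b} ({a, b} ∪ {x, y}) (by intro z; simp; tauto)
        rwa [Finset.card_insert_of_notMem (by simpa using hy), Finset.card_pair hab] at this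
      have h5 : (1 : ℝ) ≤ (if x = a then 1 else 0) + (if x = b then 1 else 0) +
        (if y = a then 1 else 0) + (if y = b then 1 else 0) := by
        split_ifs <;> first | (exfalso; tauto) | norm_num
      have h6 : (0 : ℝ) ≤ (if (x, y) = (a, b) then 1 else 0) +
          (if (x, y) = (b, a) then 1 else 0) := by positivity
      nlinarith [mul_nonneg h2 h6, mul_le_mul_of_nonneg_left h5 h3]
  · have h6 : (0 : ℝ) ≤ (if (x, y) = (a, b) then 1 else 0) +
          (if (x, y) = (b, a) then 1 else 0) := by positivity
    by_cases hy : y = a ∨ y = b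
    · have : (p : ℝ) ^ ({a, b} ∪ {x, y} : Finset (Fin n)).card ≤ (p : ℝ) ^ 3 := by
        have := hmono {x, a, b} ({a, b} ∪ {x, y}) (by intro z; simp; tauto)
        rwa [Finset.card_insert_of_notMem (by simpa using hx), Finset.card_pair hab] at this
      have h5 : (1 : ℝ) ≤ (if x = a then 1 else 0) + (if x = b then 1 else 0) +
        (if y = a then 1 else 0) + (if y = b then 1 else 0) := by
        split_ifs <;> first | (exfalso; tauto) | norm_num
      nlinarith [mul_nonneg h2 h6, mul_le_mul_of_nonneg_left h5 h3]
    · have h5 : (0 : ℝ) ≤ (if x = a then 1 else 0) + (if x = b then 1 else 0) +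
        (if y = a then 1 else 0) + (if y = b then 1 else 0) := by positivity
      have : ({a, b} ∪ {x, y} : Finset (Fin n)).card = 4 := by
        rw [Finset.card_union_of_disjoint, Finset.card_pair hab, Finset.card_pair hxy]
        simp only [Finset.disjoint_insert_right, Finset.disjoint_singleton_right,
          Finset.mem_insert, Finset.mem_singleton]
        exact ⟨hx, hy⟩
      rw [this]
      nlinarith [mul_nonneg h2 h6, mul_nonneg h3 h5]

theorem integral_adjCount_sq_le (p : unitInterval) (G : SimpleGraph (Fin n)) :
    ∫ ω, (adjCount G (chosen ω) : ℝ) ^ 2 ∂(randomSubset n p) ≤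
      (adjPairs G).card * ((adjPairs G).card * (p : ℝ) ^ 4 + 4 * n * (p : ℝ) ^ 3
        + 2 * (p : ℝ) ^ 2) := by
  classical
  have h1 : ∀ ω : Fin n → Bool, (adjCount G (chosen ω) : ℝ) ^ 2 =
      ∑ q ∈ adjPairs G, ∑ q' ∈ adjPairs G,
        if ({q.1, q.2} ∪ {q'.1, q'.2} : Finset (Fin n)) ⊆ chosen ω then (1 : ℝ) else 0 := by
    intro ω
    rw [sq, adjCount_chosen, Finset.sum_mul_sum]
    refine Finset.sum_congr rfl fun q _ => Finset.sum_congr rfl fun q' _ => ?_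
    simp only [Finset.union_subset_iff, ite_and, mul_ite, mul_one, mul_zero]
    split_ifs <;> rfl
  simp only [h1]
  rw [integral_finsetSum _ fun _ _ => Integrable.of_finite]
  have h2 : ∀ q ∈ adjPairs G, ∫ ω, ∑ q' ∈ adjPairs G,
      (if ({q.1, q.2} ∪ {q'.1, q'.2} : Finset (Fin n)) ⊆ chosen ω then (1 : ℝ) else 0)
        ∂(randomSubset n p) ≤ (adjPairs G).card * (p : ℝ) ^ 4 + 4 * n * (p : ℝ) ^ 3
        + 2 * (p : ℝ) ^ 2 := by
    intro q hq
    rw [integral_finsetSum _ fun _ _ => Integrable.of_finite]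
    simp only [integral_subset_chosen]
    have hq' : ∀ q ∈ adjPairs G, q.1 ≠ q.2 := fun q hq => (Finset.mem_filter.1 hq).2.ne
    refine (Finset.sum_le_sum fun q' h' => pow_card_pair_union_le p (hq' q hq) (hq' q' h')).trans ?_
    -- Degrees are bounded crudely by `n`; the four incidence indicators thus give the term `4np³`.
    have hfst : ∀ c : Fin n, ∑ q' ∈ adjPairs G, (if q'.1 = c then (1 : ℝ) else 0) ≤ n := by
      intro c
      rw [Finset.sum_boole]
      calc (((adjPairs G).filter fun q' => q'.1 = c).card : ℝ)
          ≤ ((Finset.univ : Finset (Fin n)).card : ℝ) := by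
            refine Nat.cast_le.2 (Finset.card_le_card_of_injOn Prod.snd (by simp) ?_)
            intro u hu v hv h
            simp only [Finset.coe_filter, Set.mem_ofPred_eq] at hu hv
            exact Prod.ext (hu.2.trans hv.2.symm) h
        _ = n := by simp
    have hsnd : ∀ c : Fin n, ∑ q' ∈ adjPairs G, (if q'.2 = c then (1 : ℝ) else 0) ≤ n := by
      intro c
      rw [Finset.sum_boole]
      calc (((adjPairs G).filter fun q' => q'.2 = c).card : ℝ)
          ≤ ((Finset.univ : Finset (Fin n)).card : ℝ) := by
            refine Nat.cast_le.2 (Finset.card_le_card_of_injOn Prod.fst (by simp) ?_)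
            intro u hu v hv h
            simp only [Finset.coe_filter, Set.mem_ofPred_eq] at hu hv
            exact Prod.ext h (hu.2.trans hv.2.symm)
        _ = n := by simp
    have heq : ∀ c : Fin n × Fin n, ∑ q' ∈ adjPairs G, (if q' = c then (1 : ℝ) else 0) ≤ 1 := by
      intro c
      rw [Finset.sum_ite_eq']
      split_ifs <;> simp
    have hp3 : (0 : ℝ) ≤ (p : ℝ) ^ 3 := pow_nonneg p.2.1 _
    have hp2 : (0 : ℝ) ≤ (p : ℝ) ^ 2 := pow_nonneg p.2.1 _
    simp only [Finset.sum_add_distrib, ← Finset.mul_sum, Finset.sum_const, nsmul_eq_mul]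
    have e1 := mul_le_mul_of_nonneg_left (add_le_add (add_le_add (add_le_add (hfst q.1)
      (hfst q.2)) (hsnd q.1)) (hsnd q.2)) hp3
    have e2 := mul_le_mul_of_nonneg_left (add_le_add (heq (q.1, q.2)) (heq (q.2, q.1))) hp2
    simp only [Prod.mk.eta] at e2 ⊢
    linarith
  refine (Finset.sum_le_sum h2).trans_eq ?_
  rw [Finset.sum_const, nsmul_eq_mul]

/-- The `p⁴` term of the second moment, from disjoint pairs, is absorbed by the squared mean. -/
theorem variance_adjCount_le (p : unitInterval) (G : SimpleGraph (Fin n)) :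
    Var[fun ω => (adjCount G (chosen ω) : ℝ); randomSubset n p] ≤
      (adjPairs G).card * (4 * n * (p : ℝ) ^ 3 + 2 * (p : ℝ) ^ 2) := by
  rw [variance_eq_sub MemLp.of_discrete, integral_adjCount]
  have := integral_adjCount_sq_le p G
  simp only [Pi.pow_apply]
  linarith

/-- The law of `t` independent random subsets. -/
noncomputable abbrev randomSubsets (n t : ℕ) (p : unitInterval) :
    Measure (Fin t → Fin n → Bool) :=
  Measure.pi fun _ => randomSubset n p

theorem integral_sum_adjCount (t : ℕ) (p : unitInterval) (G : SimpleGraph (Fin n)) :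
    ∫ ω, ∑ i, (adjCount G (chosen (ω i)) : ℝ) ∂(randomSubsets n t p) =
      t * ((adjPairs G).card * (p : ℝ) ^ 2) := by
  rw [integral_finsetSum _ fun _ _ => Integrable.of_finite]
  simp only [integral_comp_eval (μ := fun _ : Fin t => randomSubset n p)
    (f := fun ω => (adjCount G (chosen ω) : ℝ)) .of_discrete, integral_adjCount]
  simp

theorem variance_sum_adjCount_le (t : ℕ) (p : unitInterval) (G : SimpleGraph (Fin n)) :
    Var[fun ω => ∑ i, (adjCount G (chosen (ω i)) : ℝ); randomSubsets n t p] ≤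
      t * ((adjPairs G).card * (4 * n * (p : ℝ) ^ 3 + 2 * (p : ℝ) ^ 2)) := by
  have h := variance_sum_pi (μ := fun _ : Fin t => randomSubset n p)
    (X := fun _ ω => (adjCount G (chosen ω) : ℝ)) fun _ => MemLp.of_discrete
  have h' : (∑ i : Fin t, fun ω : Fin t → Fin n → Bool => (adjCount G (chosen (ω i)) : ℝ)) =
      fun ω => ∑ i, (adjCount G (chosen (ω i)) : ℝ) := by
    funext ω; simp
  rw [h'] at h
  rw [h]
  simp only [Finset.sum_const, Finset.card_univ, Fintype.card_fin, nsmul_eq_mul]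
  gcongr
  exact variance_adjCount_le p G

end RandomSubset

end Probability

/-! ### Sampling estimators and the search for the right scale. -/

section Estimator

open MeasureTheory ProbabilityTheory

variable {n : ℕ}

/-- The number of edges, rescaled from the edge count in `t` sampled vertex sets, is found with a
bounded number of queries unless the samples contain too many edges. -/
theorem exists_sample_estimator {d : ℕ} (hd : 1 ≤ d) (hn : n ≤ 2 ^ d) (t b : ℕ) (p : ℝ) :
    ∃ f : (Fin t → Fin n → Bool) → SimpleGraph (Fin n) → ℝ,
      (∀ ω, ISComputable Set.univ (f ω) fun _ => b) ∧
      ∀ ω G, f ω G = (∑ i, (adjCount G (chosen (ω i)) : ℝ)) / (2 * t * p ^ 2) ∨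
        b < ∑ i, (1 + 3 * d * adjCount G (chosen (ω i))) := by
  have h : ∀ ω : Fin t → Fin n → Bool, ∃ f' : SimpleGraph (Fin n) → ℝ,
      ISComputable Set.univ f' (fun _ => b) ∧ ∀ G,
        f' G = (∑ i, (adjCount G (chosen (ω i)) : ℝ)) / (2 * t * p ^ 2) ∨
        b < ∑ i, (1 + 3 * d * adjCount G (chosen (ω i))) := by
    intro ω
    have h1 : ISComputable Set.univ (fun G => ∑ i, adjCount G (chosen (ω i)))
        (fun G => ∑ i, (1 + 3 * d * adjCount G (chosen (ω i)))) :=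
      ISComputable.sum Finset.univ fun i _ => isComputable_adjCount hd _
        ((Finset.card_le_univ _).trans (by simpa using hn))
    obtain ⟨f', hf', hval⟩ := (h1.map fun k : ℕ => (k : ℝ) / (2 * t * p ^ 2)).exists_truncate 0 b
    refine ⟨f', hf', fun G => ?_⟩
    rcases hval G trivial with h2 | h2
    · left; rw [h2]; push_cast; rfl
    · exact Or.inr h2.2
  choose f hf hf' using h
  exact ⟨f, hf, hf'⟩

theorem integral_const_add_const_mul {Ω : Type*} [MeasurableSpace Ω] [DiscreteMeasurableSpace Ω]
    [Finite Ω] (μ : Measure Ω) [IsProbabilityMeasure μ] (a b : ℝ) (Z : Ω → ℝ) :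
    ∫ ω, a + b * Z ω ∂μ = a + b * ∫ ω, Z ω ∂μ := by
  rw [integral_add Integrable.of_finite Integrable.of_finite, integral_const_mul]
  simp

/-- Failure means a large deviation (Chebyshev) or an exhausted query budget (Markov), each of
probability at most `1/30`. The floor `1/(4p²)` in the error keeps the bound meaningful when `m` is
too small for relative accuracy at this `p`. -/
theorem measureReal_sample_estimator_bad_le {d t b : ℕ} (hd : 1 ≤ d) {p : unitInterval}
    {ε : ℝ} (hp : 1 / 2 ≤ n * (p : ℝ)) (hε : 0 < ε) (ht : 480 * n * (p : ℝ) / ε ^ 2 ≤ t)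
    (hb : 750 * d * t ≤ b) {f : (Fin t → Fin n → Bool) → SimpleGraph (Fin n) → ℝ}
    {G : SimpleGraph (Fin n)}
    (hf : ∀ ω, f ω G = (∑ i, (adjCount G (chosen (ω i)) : ℝ)) / (2 * t * (p : ℝ) ^ 2) ∨
        b < ∑ i, (1 + 3 * d * adjCount G (chosen (ω i))))
    (hm : (G.edgeSet.ncard : ℝ) * (p : ℝ) ^ 2 ≤ 4) :
    (randomSubsets n t p).real {ω | ε * max (G.edgeSet.ncard : ℝ) (1 / (4 * (p : ℝ) ^ 2)) <
      |f ω G - G.edgeSet.ncard|} ≤ 1 / 15 := by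
  set m : ℝ := (G.edgeSet.ncard : ℝ) with hmdef
  set M' : ℝ := max m (1 / (4 * (p : ℝ) ^ 2)) with hM'
  have hm0 : 0 ≤ m := by positivity
  have hp0 : 0 < (p : ℝ) := by
    rcases p.2.1.lt_or_eq with h | h
    · exact h
    · rw [← h] at hp; norm_num at hp
  have hn0 : 0 < (n : ℝ) := by
    rcases (Nat.cast_nonneg n : (0 : ℝ) ≤ n).lt_or_eq with h | h
    · exact h
    · rw [← h] at hp; norm_num at hp
  have ht0 : 0 < (t : ℝ) := lt_of_lt_of_le (by positivity) ht
  have hM'0 : 0 < M' := lt_of_lt_of_le (by positivity) (le_max_right _ _)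
  have ha : ((adjPairs G).card : ℝ) = 2 * m := by rw [card_adjPairs]; push_cast; rfl
  set Z : (Fin t → Fin n → Bool) → ℝ := fun ω => ∑ i, (adjCount G (chosen (ω i)) : ℝ) with hZ
  set μ := randomSubsets n t p with hμ
  have hEZ : ∫ ω, Z ω ∂μ = t * (2 * m * (p : ℝ) ^ 2) := by
    rw [← ha]; exact integral_sum_adjCount t p G
  have hVar : Var[Z; μ] ≤ t * (2 * m * (4 * n * (p : ℝ) ^ 3 + 2 * (p : ℝ) ^ 2)) := by
    rw [← ha]; exact variance_sum_adjCount_le t p G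
  have hc0 : 0 < 2 * t * (p : ℝ) ^ 2 * (ε * M') := by positivity
  have hcheb : μ.real {ω | 2 * t * (p : ℝ) ^ 2 * (ε * M') ≤ |Z ω - ∫ ω, Z ω ∂μ|} ≤ 1 / 30 := by
    have h1 := meas_ge_le_variance_div_sq (μ := μ) (X := Z) MemLp.of_discrete hc0
    have h2 := ENNReal.toReal_le_of_le_ofReal
      (div_nonneg (variance_nonneg _ _) (sq_nonneg _)) h1
    refine h2.trans ?_
    rw [div_le_iff₀ (by positivity)]
    refine hVar.trans ?_
    have e1 : m ≤ 4 * (p : ℝ) ^ 2 * M' ^ 2 := by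
      have e3 : 1 ≤ 4 * (p : ℝ) ^ 2 * M' := by
        have := le_max_right m (1 / (4 * (p : ℝ) ^ 2))
        rw [← hM', div_le_iff₀ (by positivity)] at this
        linarith
      calc m ≤ M' := le_max_left _ _
        _ = 1 * M' := (one_mul _).symm
        _ ≤ (4 * (p : ℝ) ^ 2 * M') * M' := by gcongr
        _ = _ := by ring
    have e2 : 480 * n * (p : ℝ) ≤ t * ε ^ 2 := by rwa [div_le_iff₀ (by positivity)] at ht
    have e4 : 2 * (p : ℝ) ^ 2 ≤ 4 * n * (p : ℝ) ^ 3 := by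
      have := mul_le_mul_of_nonneg_right hp (by positivity : 0 ≤ 4 * (p : ℝ) ^ 2)
      nlinarith
    -- By `np ≥ 1/2` the `p³` term dominates the variance, and `m ≤ 4p²M'²`. The constant is `480 =
    -- 30 · 64 / 4`.
    calc t * (2 * m * (4 * n * (p : ℝ) ^ 3 + 2 * (p : ℝ) ^ 2))
        ≤ t * (2 * m * (4 * n * (p : ℝ) ^ 3 + 4 * n * (p : ℝ) ^ 3)) := by gcongr
      _ = t * (16 * (n * (p : ℝ)) * (p : ℝ) ^ 2 * m) := by ring
      _ ≤ t * (16 * (n * (p : ℝ)) * (p : ℝ) ^ 2 * (4 * (p : ℝ) ^ 2 * M' ^ 2)) := by gcongr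
      _ = (480 * n * (p : ℝ)) * (t * (p : ℝ) ^ 4 * M' ^ 2 * (4 / 30)) := by ring
      _ ≤ (t * ε ^ 2) * (t * (p : ℝ) ^ 4 * M' ^ 2 * (4 / 30)) := by gcongr
      _ = _ := by ring
  set Q : (Fin t → Fin n → Bool) → ℝ := fun ω => t + 3 * d * Z ω with hQ
  have hEQ : ∫ ω, Q ω ∂μ ≤ 25 * d * t := by
    have hQZ : ∫ ω, Q ω ∂μ = t + 3 * d * ∫ ω, Z ω ∂μ := integral_const_add_const_mul μ _ _ _
    rw [hQZ, hEZ]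
    have : (1 : ℝ) ≤ d := by exact_mod_cast hd
    have h3 : (d : ℝ) * t * (m * (p : ℝ) ^ 2) ≤ d * t * 4 := by gcongr
    have h4 : 1 * (t : ℝ) ≤ d * t := by gcongr
    linarith
  have hQ0 : ∀ ω, 0 ≤ Q ω := fun ω =>
    add_nonneg ht0.le (mul_nonneg (by positivity) (Finset.sum_nonneg fun _ _ => Nat.cast_nonneg _))
  -- Here `750 = 30 · 25`, where `25 = 1 + 3 · 2 · 4` comes from at most four expected edges,
  -- counted as ordered pairs.
  have hmarkov : μ.real {ω | (750 * d * t : ℝ) ≤ Q ω} ≤ 1 / 30 := by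
    have h1 := mul_meas_ge_le_integral_of_nonneg (μ := μ) (f := Q)
      (Filter.Eventually.of_forall hQ0) Integrable.of_finite (750 * d * t)
    have h2 : (0 : ℝ) < d * t := by
      have : (0 : ℝ) < d := by exact_mod_cast hd
      positivity
    have h3 := h1.trans hEQ
    by_contra! hlt
    have := mul_lt_mul_of_pos_left hlt h2
    linarith
  have hsub : {ω | ε * M' < |f ω G - m|} ⊆
      {ω | 2 * t * (p : ℝ) ^ 2 * (ε * M') ≤ |Z ω - ∫ ω, Z ω ∂μ|} ∪
      {ω | (750 * d * t : ℝ) ≤ Q ω} := by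
    intro ω hω
    rcases hf ω with h | h
    · left
      simp only [Set.mem_ofPred_eq] at hω ⊢
      rw [h] at hω
      have e : Z ω - ∫ ω, Z ω ∂μ = 2 * t * (p : ℝ) ^ 2 * (Z ω / (2 * t * (p : ℝ) ^ 2) - m) := by
        rw [hEZ]; field_simp
      rw [e, abs_mul, abs_of_pos (by positivity : 0 < 2 * t * (p : ℝ) ^ 2)]
      gcongr
    · right
      have h1 : ((∑ i, (1 + 3 * d * adjCount G (chosen (ω i))) : ℕ) : ℝ) = Q ω := by
        simp only [hQ, hZ, Finset.sum_add_distrib, ← Finset.mul_sum]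
        push_cast
        simp [Finset.mul_sum]
      simp only [Set.mem_ofPred_eq]
      rw [← h1]
      exact_mod_cast hb.trans h.le
  calc μ.real {ω | ε * M' < |f ω G - m|} ≤ _ := measureReal_mono hsub
    _ ≤ _ := measureReal_union_le _ _
    _ ≤ 1 / 30 + 1 / 30 := add_le_add hcheb hmarkov
    _ = 1 / 15 := by norm_num

/-- The median of `g` sample estimators fails with probability exponentially small in `g`. -/
theorem exists_median_estimator {d : ℕ} (hd : 1 ≤ d) (hn : n ≤ 2 ^ d) (g t : ℕ)
    {p : unitInterval} {ε : ℝ} (hp : 1 / 2 ≤ n * (p : ℝ)) (hε : 0 < ε)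
    (ht : 480 * n * (p : ℝ) / ε ^ 2 ≤ t) :
    ∃ y : (Fin g → Fin t → Fin n → Bool) → SimpleGraph (Fin n) → ℝ,
      (∀ ω, ISComputable Set.univ (y ω) fun _ => g * (750 * d * t)) ∧
      ∀ G : SimpleGraph (Fin n), (G.edgeSet.ncard : ℝ) * (p : ℝ) ^ 2 ≤ 4 →
        (Measure.pi fun _ : Fin g => randomSubsets n t p).real
          {ω | ε * max (G.edgeSet.ncard : ℝ) (1 / (4 * (p : ℝ) ^ 2)) <
            |y ω G - G.edgeSet.ncard|} ≤ (1 / 2) ^ g := by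
  classical
  obtain ⟨f, hf, hval⟩ := exists_sample_estimator hd hn t (750 * d * t) (p : ℝ)
  refine ⟨fun ω G => median fun i => f (ω i) G, fun ω => ?_, fun G hG => ?_⟩
  · refine ISComputable.mono ((ISComputable.pi fun i => hf (ω i)).map median) subset_rfl
      (fun _ _ => rfl) ?_
    intro G _
    simp
  · have h1 := measureReal_sample_estimator_bad_le hd hp hε ht le_rfl (fun ω => hval ω G) hG
    refine (measureReal_mono fun ω hω => ?_).trans
      (measureReal_pi_half_bad_le (randomSubsets n t p) g h1)
    simp only [Set.mem_ofPred_eq] at hω ⊢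
    by_contra! hlt
    set K := ε * max (G.edgeSet.ncard : ℝ) (1 / (4 * (p : ℝ) ^ 2))
    refine absurd (median_mem (fun i => f (ω i) G) (a := G.edgeSet.ncard - K)
      (b := G.edgeSet.ncard + K) ?_) ?_
    · have hfil : (Finset.univ.filter fun i => (G.edgeSet.ncard : ℝ) - K ≤ f (ω i) G ∧
          f (ω i) G ≤ G.edgeSet.ncard + K) =
          Finset.univ.filter fun i => ¬ (K < |f (ω i) G - G.edgeSet.ncard|) := by
        ext i
        simp only [Finset.mem_filter, Finset.mem_univ, true_and, not_lt, abs_le]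
        constructor <;> rintro ⟨h, h'⟩ <;> constructor <;> linarith
      have := Finset.card_filter_add_card_filter_not (s := (Finset.univ : Finset (Fin g)))
        (fun i => K < |f (ω i) G - G.edgeSet.ncard|)
      rw [Finset.card_univ, Fintype.card_fin] at this
      rw [hfil]
      omega
    · rintro ⟨h2, h3⟩
      exact absurd hω (not_lt.2 (abs_le.2 ⟨by linarith, by linarith⟩))

/-- Output the value `y k` for the largest `k < N` for which it reaches the threshold `θ k`. -/
theorem exists_isComputable_last_accepted {y : ℕ → SimpleGraph (Fin n) → ℝ} {q : ℕ → ℕ}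
    (θ : ℕ → ℝ) (N : ℕ) (h : ∀ k < N, ISComputable Set.univ (y k) fun _ => q k) :
    ∃ F : SimpleGraph (Fin n) → ℝ,
      ISComputable Set.univ F (fun _ => ∑ k ∈ Finset.range N, q k) ∧
      ∀ G, ∀ k < N, θ k ≤ y k G → (∀ i < N, k < i → y i G < θ i) → F G = y k G := by
  classical
  induction N with
  | zero => exact ⟨fun _ => 0, by simpa using ISComputable.const 0, by simp⟩
  | succ N ih =>
    obtain ⟨F, hF, hF'⟩ := ih fun k hk => h k (by omega)
    -- The largest scale is evaluated first, and smaller ones only if it is rejected.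
    refine ⟨fun G => if θ N ≤ y N G then y N G else F G, ?_, ?_⟩
    · refine ISComputable.mono ((h N (by omega)).bind
        (g := fun a G => if θ N ≤ a then a else F G)
        (r := fun _ _ => ∑ k ∈ Finset.range N, q k) fun a => ?_) subset_rfl (fun _ _ => rfl) ?_
      · by_cases ha : θ N ≤ a
        · simp only [ha, if_true]
          exact (ISComputable.const a).mono subset_rfl (fun _ _ => rfl) (by simp)
        · simp only [ha, if_false]
          exact hF.mono (by simp) (fun _ _ => rfl) (fun _ _ => le_rfl)
      · intro G _
        rw [Finset.sum_range_succ, add_comm]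
    · intro G k hk hθ hlast
      rcases Nat.lt_succ_iff_lt_or_eq.1 hk with hk' | rfl
      · simp only [if_neg (not_le.2 (hlast N (by omega) hk'))]
        exact hF' G k hk' hθ fun i hi => hlast i (by omega)
      · simp only [if_pos hθ]

/-- If the estimates at all relevant scales are good, then the last accepted one is. -/
theorem exists_last_accepted {ε : ℝ} (hε' : ε ≤ 1 / 2) {J N m : ℕ}
    (hm : 4 ^ J ≤ m) (hm' : m < 4 ^ (J + N)) {y : ℕ → ℝ}
    (hy : ∀ k < N, (m : ℝ) ≤ 4 * 4 ^ (J + k) → |y k - m| ≤ ε * max (m : ℝ) (4 ^ (J + k) / 4)) :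
    ∃ k < N, 4 ^ (J + k) / 2 ≤ y k ∧ (∀ i < N, k < i → y i < 4 ^ (J + i) / 2) ∧
      |y k - m| ≤ ε * m := by
  classical
  have hm0 : m ≠ 0 := by have : 0 < 4 ^ J := by positivity
                         omega
  have hJ : J ≤ Nat.log 4 m := Nat.le_log_of_pow_le (by norm_num) hm
  have hN : Nat.log 4 m < J + N := Nat.log_lt_of_lt_pow hm0 hm'
  -- `J + k₀` is the true scale of `m`. Its estimate is accepted since `ε ≤ 1/2`, so the last
  -- accepted index is at least `k₀`, and scales too small for a guarantee never matter.
  obtain ⟨k₀, hk₀⟩ := Nat.exists_eq_add_of_le hJ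
  have h1 : (4 : ℝ) ^ (J + k₀) ≤ m := by
    rw [← hk₀]; exact_mod_cast Nat.pow_log_le_self 4 hm0
  have h2 : (m : ℝ) ≤ 4 * 4 ^ (J + k₀) := by
    have := (Nat.lt_pow_succ_log_self (b := 4) (by norm_num) m).le
    rw [hk₀, pow_succ'] at this
    exact_mod_cast this
  have hlarge : ∀ k < N, (4 : ℝ) ^ (J + k) / 4 ≤ m → (m : ℝ) ≤ 4 * 4 ^ (J + k) →
      |y k - m| ≤ ε * m := fun k hk h h' => by
    have := hy k hk h'
    rwa [max_eq_left h] at this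
  have hacc : 4 ^ (J + k₀) / 2 ≤ y k₀ := by
    have h0 : (0 : ℝ) < 4 ^ (J + k₀) := by positivity
    have := (abs_le.1 (hlarge k₀ (by omega) (by linarith) h2)).1
    nlinarith
  set P : ℕ → Prop := fun k => (4 : ℝ) ^ (J + k) / 2 ≤ y k
  have hk : P (Nat.findGreatest P (N - 1)) := Nat.findGreatest_spec (m := k₀) (by omega) hacc
  have hk₀k : k₀ ≤ Nat.findGreatest P (N - 1) := Nat.le_findGreatest (by omega) hacc
  have hkN : Nat.findGreatest P (N - 1) ≤ N - 1 := Nat.findGreatest_le _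
  have hgt : ∀ i < N, Nat.findGreatest P (N - 1) < i → y i < 4 ^ (J + i) / 2 :=
    fun i hi hki => not_le.1 (Nat.findGreatest_is_greatest hki (by omega))
  generalize Nat.findGreatest P (N - 1) = k at *
  refine ⟨k, by omega, hk, hgt, ?_⟩
  have h3 : (m : ℝ) ≤ 4 * 4 ^ (J + k) :=
    h2.trans (by gcongr; norm_num)
  refine hlarge k (by omega) ?_ h3
  -- A scale with `m < 4 ^ (J + k) / 4` has estimate below `(1/4 + 1/8) · 4 ^ (J + k)`, too small to
  -- be accepted.
  by_contra! hlt
  have h4 := hy k (by omega) h3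
  rw [max_eq_right hlt.le] at h4
  have h5 : (0 : ℝ) < 4 ^ (J + k) := by positivity
  have h6 := (abs_le.1 h4).2
  have h7 : (4 : ℝ) ^ (J + k) / 2 ≤ y k := hk
  nlinarith

/-- A random choice of a deterministic algorithm. -/
theorem exists_randomizedISAlgorithm {Ω : Type*} [MeasurableSpace Ω] [DiscreteMeasurableSpace Ω]
    [Finite Ω] (P : Measure Ω) [IsProbabilityMeasure P] (T : Ω → ISDecisionTree n) :
    ∃ A : RandomizedISAlgorithm n, (∀ T' ∈ A.support, ∃ ω, T ω = T') ∧
      ∀ (ε : ℝ) (G : SimpleGraph (Fin n)), A.successProb ε G =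
        P {ω | IsApprox ε (G.edgeSet.ncard : ℝ) ((T ω).eval G)} := by
  refine ⟨P.toPMF.map T, fun T' hT' => ?_, fun ε G => ?_⟩
  · rw [PMF.support_map] at hT'
    obtain ⟨ω, -, h⟩ := hT'
    exact ⟨ω, h⟩
  · rw [RandomizedISAlgorithm.successProb, PMF.toOuterMeasure_map_apply,
      ← PMF.toMeasure_apply_eq_toOuterMeasure, Measure.toPMF_toMeasure]
    rfl

end Estimator

/-! ### Assembly of the algorithm and choice of parameters. -/

section Main

open MeasureTheory ProbabilityTheory

variable {n : ℕ}

/-- The probability `2⁻ᵏ`. -/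
noncomputable def dyadicProb (k : ℕ) : unitInterval :=
  ⟨(1 / 2) ^ k, by positivity, pow_le_one₀ (by norm_num) (by norm_num)⟩

theorem coe_dyadicProb (k : ℕ) : (dyadicProb k : ℝ) = (1 / 2) ^ k := rfl

theorem coe_dyadicProb_sq (k : ℕ) : (dyadicProb k : ℝ) ^ 2 = 1 / 4 ^ k := by
  rw [coe_dyadicProb, ← pow_mul, mul_comm, pow_mul, ← one_div_pow]
  norm_num

theorem two_mul_ncard_edgeSet_le (G : SimpleGraph (Fin n)) : 2 * G.edgeSet.ncard ≤ n ^ 2 := by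
  classical
  rw [← card_adjPairs, sq]
  simpa using Finset.card_le_univ (adjPairs G)

/-- Count exactly if there are at most `4 ^ J` edges, and otherwise use the estimators at the
scales `4 ^ (J + k)` for `k < N`, starting with the largest. -/
theorem exists_edge_estimator {d J N g : ℕ} (hd : 1 ≤ d) (hn : n ≤ 2 ^ d) {ε : ℝ} (hε : 0 < ε)
    (hε' : ε ≤ 1 / 2) (hp : ∀ k < N, 1 / 2 ≤ n * (dyadicProb (J + k) : ℝ)) {t : ℕ → ℕ}
    (ht : ∀ k < N, 480 * n * (dyadicProb (J + k) : ℝ) / ε ^ 2 ≤ t k)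
    (hJN : n ^ 2 < 2 * 4 ^ (J + N)) :
    ∃ A : RandomizedISAlgorithm n, ∀ G : SimpleGraph (Fin n),
      A.QueriesAtMost G
        ((1 + 6 * d * 4 ^ J + ∑ k ∈ Finset.range N, g * (750 * d * t k) : ℕ) : ℝ) ∧
      ENNReal.ofReal (1 - N * (1 / 2) ^ g) ≤ A.successProb ε G := by
  classical
  have hlevel : ∀ k : Fin N, ∃ y : (Fin g → Fin (t k) → Fin n → Bool) → SimpleGraph (Fin n) → ℝ,
      (∀ ω, ISComputable Set.univ (y ω) fun _ => g * (750 * d * t k)) ∧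
      ∀ G : SimpleGraph (Fin n), (G.edgeSet.ncard : ℝ) ≤ 4 * 4 ^ (J + (k : ℕ)) →
        (Measure.pi fun _ : Fin g => randomSubsets n (t k) (dyadicProb (J + k))).real
          {ω | ε * max (G.edgeSet.ncard : ℝ) (4 ^ (J + (k : ℕ)) / 4) <
            |y ω G - G.edgeSet.ncard|} ≤ (1 / 2) ^ g := by
    intro k
    obtain ⟨y, hy, hy'⟩ := exists_median_estimator hd hn g (t k) (hp k k.2) hε (ht k k.2)
    refine ⟨y, hy, fun G hG => ?_⟩
    have h4 : (0 : ℝ) < 4 ^ (J + (k : ℕ)) := by positivity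
    have h1 := hy' G (by rw [coe_dyadicProb_sq, mul_one_div, div_le_iff₀ h4]; exact hG)
    have h2 : 1 / (4 * (dyadicProb (J + (k : ℕ)) : ℝ) ^ 2) = 4 ^ (J + (k : ℕ)) / 4 := by
      rw [coe_dyadicProb_sq]; field_simp
    rwa [h2] at h1
  choose y hy hybad using hlevel
  -- The budget `1 + 6d · 4ᴶ` suffices for `4ᴶ` edges. The default `-1` cannot be an edge count, so
  -- it signals `m > 4ᴶ`.
  obtain ⟨e, he, heval⟩ := ((isComputable_adjCount (n := n) hd Finset.univ
    (by simpa using hn)).map fun a : ℕ => (a : ℝ) / 2).exists_truncate (-1) (1 + 6 * d * 4 ^ J)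
  have heval' : ∀ G, (e G = G.edgeSet.ncard) ∨ (e G = -1 ∧ 4 ^ J < G.edgeSet.ncard) := by
    intro G
    rcases heval G trivial with h | ⟨h, h'⟩
    · left
      rw [h, adjCount_univ, card_adjPairs]
      push_cast; ring
    · right
      refine ⟨h, ?_⟩
      rw [adjCount_univ, card_adjPairs] at h'
      have h'' : 6 * d * 4 ^ J < 6 * d * G.edgeSet.ncard := by linarith
      exact lt_of_mul_lt_mul_left h'' (by positivity)
  set Ω := ∀ k : Fin N, Fin g → Fin (t k) → Fin n → Bool
  set P : Measure Ω := Measure.pi fun k : Fin N =>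
    Measure.pi fun _ : Fin g => randomSubsets n (t k) (dyadicProb (J + k)) with hP
  set y' : Ω → ℕ → SimpleGraph (Fin n) → ℝ :=
    fun ω k G => if h : k < N then y ⟨k, h⟩ (ω ⟨k, h⟩) G else 0 with hy'
  have hy'c : ∀ ω, ∀ k < N, ISComputable Set.univ (y' ω k) fun _ => g * (750 * d * t k) := by
    intro ω k hk
    simp only [hy', hk, dif_pos]
    exact hy ⟨k, hk⟩ _
  choose F hF hF' using fun ω : Ω =>
    exists_isComputable_last_accepted (fun k => (4 : ℝ) ^ (J + k) / 2) N (hy'c ω)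
  have hT : ∀ ω : Ω, ∃ T : ISDecisionTree n, ∀ G, T.eval G = (if 0 ≤ e G then e G else F ω G) ∧
      T.numQueries G ≤ 1 + 6 * d * 4 ^ J + ∑ k ∈ Finset.range N, g * (750 * d * t k) := by
    intro ω
    have h1 := he.bind (g := fun a G => if 0 ≤ a then a else F ω G)
      (r := fun _ _ => ∑ k ∈ Finset.range N, g * (750 * d * t k)) fun a => by
        by_cases ha : 0 ≤ a
        · simp only [ha, if_true]
          exact (ISComputable.const a).mono subset_rfl (fun _ _ => rfl) (by simp)
        · simp only [ha, if_false]
          exact (hF ω).mono (by simp) (fun _ _ => rfl) (fun _ _ => le_rfl)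
    obtain ⟨T, hT⟩ := h1 .output
    exact ⟨T, fun G => by simpa [ISDecisionTree.eval, ISDecisionTree.numQueries] using hT G trivial⟩
  choose T hTeval hTq using hT
  obtain ⟨A, hA, hAs⟩ := exists_randomizedISAlgorithm P T
  refine ⟨A, fun G => ⟨?_, ?_⟩⟩
  · intro T' hT'
    obtain ⟨ω, rfl⟩ := hA T' hT'
    exact_mod_cast hTq ω G
  rw [hAs]
  set m := G.edgeSet.ncard with hm
  -- Only scales with `m ≤ 4 · 4 ^ (J + k)` carry a guarantee, so failures at the others are not
  -- counted as bad.
  set bad : Fin N → Set Ω := fun k => {ω | (m : ℝ) ≤ 4 * 4 ^ (J + (k : ℕ)) ∧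
    ε * max (m : ℝ) (4 ^ (J + (k : ℕ)) / 4) < |y k (ω k) G - m|} with hbad
  have hbadle : ∀ k, P.real (bad k) ≤ (1 / 2) ^ g := by
    intro k
    by_cases hmk : (m : ℝ) ≤ 4 * 4 ^ (J + (k : ℕ))
    · have h1 := (measurePreserving_eval (fun k : Fin N =>
        Measure.pi fun _ : Fin g => randomSubsets n (t k) (dyadicProb (J + k))) k).measureReal_preimage
        (s := {ω | ε * max (m : ℝ) (4 ^ (J + (k : ℕ)) / 4) < |y k ω G - m|})
        (MeasurableSet.of_discrete.nullMeasurableSet)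
      have h2 := hybad k G hmk
      rw [← hm, ← h1] at h2
      refine (measureReal_mono fun ω hω => ?_).trans h2
      exact hω.2
    · have : bad k = ∅ := by
        ext ω; simp [hbad, hmk]
      rw [this]; simp
  have hunion : P.real (⋃ k, bad k) ≤ N * (1 / 2) ^ g := by
    refine (measureReal_iUnion_fintype_le _).trans ((Finset.sum_le_sum fun k _ => hbadle k).trans ?_)
    simp
  have hgood : (⋃ k, bad k)ᶜ ⊆ {ω | IsApprox ε (m : ℝ) ((T ω).eval G)} := by
    intro ω hω
    simp only [Set.mem_ofPred_eq]
    have hm0 : (0 : ℝ) ≤ m := Nat.cast_nonneg m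
    suffices h : |(T ω).eval G - m| ≤ ε * m by
      have := abs_le.1 h
      exact ⟨by linarith [this.1], by linarith [this.2]⟩
    rw [hTeval]
    rcases heval' G with h | ⟨h, hlt⟩
    · rw [h, ← hm, if_pos hm0, sub_self, abs_zero]
      positivity
    · rw [h, if_neg (by norm_num)]
      have hmlt : m < 4 ^ (J + N) := by
        have := two_mul_ncard_edgeSet_le G
        omega
      obtain ⟨k, hk, hacc, hlast, hle⟩ := exists_last_accepted hε' hlt.le hmlt
        (y := fun k => y' ω k G) (ε := ε) (by
          intro k hk hmk
          by_contra! hlt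
          refine hω (Set.mem_iUnion.2 ⟨⟨k, hk⟩, hmk, ?_⟩)
          simpa only [hy', hk, dif_pos] using hlt)
      rw [hF' ω G k hk hacc hlast]
      exact hle
  calc ENNReal.ofReal (1 - N * (1 / 2) ^ g) ≤ ENNReal.ofReal (P.real (⋃ k, bad k)ᶜ) := by
        apply ENNReal.ofReal_le_ofReal
        rw [probReal_compl_eq_one_sub MeasurableSet.of_discrete]
        linarith
    _ = P (⋃ k, bad k)ᶜ := ofReal_measureReal
    _ ≤ _ := measure_mono hgood

theorem sum_dyadicProb_le (J N : ℕ) :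
    ∑ k ∈ Finset.range N, (dyadicProb (J + k) : ℝ) ≤ 2 * (1 / 2) ^ J := by
  simp only [coe_dyadicProb, pow_add, ← Finset.mul_sum]
  rw [mul_comm]
  gcongr
  exact sum_geometric_two_le N

theorem natCast_pow_le_rpow_of_eight_pow_le {J : ℕ} (h : 8 ^ J ≤ n) :
    (4 : ℝ) ^ J ≤ (n : ℝ) ^ (2 / 3 : ℝ) := by
  have h1 : (4 : ℝ) ^ J = ((8 : ℝ) ^ J) ^ (2 / 3 : ℝ) := by
    rw [← Real.rpow_natCast, ← Real.rpow_natCast, ← Real.rpow_mul (by norm_num), mul_comm,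
      Real.rpow_mul (by norm_num)]
    congr 1
    rw [show (8 : ℝ) = 2 ^ (3 : ℝ) by norm_num, ← Real.rpow_mul (by norm_num)]
    norm_num
  rw [h1]
  exact Real.rpow_le_rpow (by positivity) (by exact_mod_cast h) (by norm_num)

theorem mul_half_pow_le_rpow_of_lt_eight_pow {J : ℕ} (h : n < 8 ^ (J + 1)) :
    (n : ℝ) * (1 / 2) ^ J ≤ 2 * (n : ℝ) ^ (2 / 3 : ℝ) := by
  rcases Nat.eq_zero_or_pos n with rfl | hn
  · simp
  have hn' : (0 : ℝ) < n := by exact_mod_cast hn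
  have h1 : (n : ℝ) ^ (1 / 3 : ℝ) ≤ 2 ^ (J + 1) := by
    have h2 : (2 : ℝ) ^ (J + 1) = ((8 : ℝ) ^ (J + 1)) ^ (1 / 3 : ℝ) := by
      rw [show (8 : ℝ) = 2 ^ 3 by norm_num, ← pow_mul, mul_comm, pow_mul, one_div]
      exact (Real.pow_rpow_inv_natCast (n := 3) (by positivity) (by norm_num)).symm
    rw [h2]
    exact Real.rpow_le_rpow hn'.le (by exact_mod_cast h.le) (by norm_num)
  have h3 : (n : ℝ) = (n : ℝ) ^ (2 / 3 : ℝ) * (n : ℝ) ^ (1 / 3 : ℝ) := by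
    rw [← Real.rpow_add hn']; norm_num
  calc (n : ℝ) * (1 / 2) ^ J
      = (n : ℝ) ^ (2 / 3 : ℝ) * (n : ℝ) ^ (1 / 3 : ℝ) * (1 / 2) ^ J := by rw [← h3]
    _ ≤ (n : ℝ) ^ (2 / 3 : ℝ) * 2 ^ (J + 1) * (1 / 2) ^ J := by gcongr
    _ = (n : ℝ) ^ (2 / 3 : ℝ) * 2 * (2 * (1 / 2)) ^ J := by rw [mul_pow, pow_succ]; ring
    _ = _ := by norm_num; ring

theorem exists_edge_estimator_of_lt_one {c ε : ℝ} {c' : ℕ} (hc0 : 0 ≤ c) (hc : c + 1 ≤ c') (hn : 2 ≤ n)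
    (hε : 0 < ε) (hε1 : ε < 1) :
    ∃ A : RandomizedISAlgorithm n, ∀ G : SimpleGraph (Fin n),
      A.QueriesAtMost G ((28 + 23136000 * c') *
        ((n : ℝ) ^ (2 / 3 : ℝ) * Real.logb 2 n ^ 2 / ε ^ 2)) ∧
      ENNReal.ofReal (1 - 1 / (n : ℝ) ^ c) ≤ A.successProb ε G := by
  have hn0 : (0 : ℝ) < n := by positivity
  have hn2 : (2 : ℝ) ≤ n := by exact_mod_cast hn
  set d := Nat.clog 2 n with hd
  have hd1 : 1 ≤ d := Nat.clog_pos (by norm_num) hn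
  have hnd : n ≤ 2 ^ d := Nat.le_pow_clog (by norm_num) n
  have hnd' : 2 ^ (d - 1) < n := Nat.pow_pred_clog_lt_self (by norm_num) hn
  have hnd'' : (2 : ℝ) ^ d ≤ 2 * n := by
    have : 2 ^ d = 2 * 2 ^ (d - 1) := by rw [← pow_succ', Nat.sub_add_cancel hd1]
    exact_mod_cast (by omega : 2 ^ d ≤ 2 * n)
  set J := Nat.log 8 n with hJ
  have hJ1 : 8 ^ J ≤ n := Nat.pow_log_le_self 8 (by omega)
  have hJ2 : n < 8 ^ (J + 1) := Nat.lt_pow_succ_log_self (by norm_num) n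
  have hJd : J ≤ d := by
    by_contra! h
    have h1 : 2 ^ d < 2 ^ J := Nat.pow_lt_pow_right (by norm_num) h
    have h2 : 2 ^ J ≤ 8 ^ J := Nat.pow_le_pow_left (by norm_num) J
    omega
  -- The finest sampling probability is `2⁻ᵈ`, the last for which `2ᵈ ≤ 2n` still gives `np ≥ 1/2`.
  set N := d + 1 - J with hN
  -- Halving the accuracy secures `ε' ≤ 1/2`, as the acceptance test requires.
  set ε' := ε / 2 with hε'
  have hε'0 : 0 < ε' := by positivity
  have hp : ∀ k < N, 1 / 2 ≤ n * (dyadicProb (J + k) : ℝ) := by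
    intro k hk
    rw [coe_dyadicProb, one_div_pow, mul_one_div, le_div_iff₀ (by positivity)]
    have : (2 : ℝ) ^ (J + k) ≤ 2 ^ d := pow_le_pow_right₀ (by norm_num) (by omega)
    linarith
  set t : ℕ → ℕ := fun k => ⌈480 * n * (dyadicProb (J + k) : ℝ) / ε' ^ 2⌉₊ with ht
  have ht' : ∀ k < N, (t k : ℝ) ≤ 482 * n / ε' ^ 2 * (dyadicProb (J + k) : ℝ) := by
    intro k hk
    have h0 : (0 : ℝ) ≤ 480 * n * (dyadicProb (J + k) : ℝ) / ε' ^ 2 := by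
      have := (dyadicProb (J + k)).2.1
      positivity
    refine (Nat.ceil_lt_add_one h0).le.trans ?_
    -- The rounding in `t k` costs at most `1`, absorbed by raising `480` to `482` because `np ≥
    -- 1/2` and `ε' ≤ 1`.
    have h1 : 1 ≤ 2 * (n * (dyadicProb (J + k) : ℝ)) / ε' ^ 2 := by
      rw [le_div_iff₀ (by positivity)]
      have := hp k hk
      nlinarith
    calc _ ≤ 480 * n * (dyadicProb (J + k) : ℝ) / ε' ^ 2
          + 2 * (n * (dyadicProb (J + k) : ℝ)) / ε' ^ 2 := by gcongr
      _ = _ := by ring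
  obtain ⟨A, hA⟩ := exists_edge_estimator (n := n) (N := N) (J := J) (g := c' * d) hd1 hnd hε'0
    (by linarith) hp (t := t) (fun k _ => Nat.le_ceil _) (by
      rw [show J + N = d + 1 by omega]
      have h1 : n ^ 2 ≤ (2 ^ d) ^ 2 := Nat.pow_le_pow_left hnd 2
      have h2 : (2 ^ d) ^ 2 = 4 ^ d := by rw [← pow_mul, mul_comm, pow_mul]; norm_num
      have h3 : 0 < 4 ^ d := by positivity
      have h4 : 4 ^ (d + 1) = 4 * 4 ^ d := pow_succ' 4 d
      linarith)
  have hL : (d : ℝ) ≤ 2 * Real.logb 2 n := by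
    have h1 : (1 : ℝ) ≤ Real.logb 2 n := by
      rw [Real.le_logb_iff_rpow_le (by norm_num) hn0]; simpa using hn2
    have h2 : ((d - 1 : ℕ) : ℝ) ≤ Real.logb 2 n := by
      rw [Real.le_logb_iff_rpow_le (by norm_num) hn0, Real.rpow_natCast]
      exact_mod_cast hnd'.le
    rw [Nat.cast_sub hd1] at h2
    push_cast at h2
    linarith
  have hd1' : (1 : ℝ) ≤ d := by exact_mod_cast hd1
  set X := (n : ℝ) ^ (2 / 3 : ℝ) with hX
  have hX0 : 0 < X := Real.rpow_pos_of_pos hn0 _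
  have hd2 : (d : ℝ) ^ 2 ≤ 4 * Real.logb 2 n ^ 2 := by nlinarith
  refine ⟨A, fun G => ⟨fun T hT => ((hA G).1 T hT).trans ?_, ?_⟩⟩
  · have h1 : (1 + 6 * d * 4 ^ J : ℝ) ≤ 7 * (d ^ 2 * X / ε ^ 2) := by
      have h4 : (4 : ℝ) ^ J ≤ X := natCast_pow_le_rpow_of_eight_pow_le hJ1
      have h5 : (1 : ℝ) ≤ 4 ^ J := one_le_pow₀ (by norm_num)
      have h6 : d * X ≤ d ^ 2 * X / ε ^ 2 := by
        rw [le_div_iff₀ (by positivity)]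
        have : ε ^ 2 ≤ 1 := pow_le_one₀ hε.le hε1.le
        calc d * X * ε ^ 2 ≤ d * X * 1 := by gcongr
          _ = d * X * 1 := rfl
          _ ≤ d * X * d := by gcongr
          _ = _ := by ring
      have h7 : (d : ℝ) * 4 ^ J ≤ d * X := by gcongr
      nlinarith
    have h2 : ∑ k ∈ Finset.range N, ((c' * d : ℕ) : ℝ) * (750 * d * t k) ≤
        5784000 * c' * (d ^ 2 * X / ε ^ 2) := by
      rw [← Finset.mul_sum, ← Finset.mul_sum]
      have h3 : ∑ k ∈ Finset.range N, (t k : ℝ) ≤ 482 / ε' ^ 2 * (4 * X) := by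
        calc ∑ k ∈ Finset.range N, (t k : ℝ)
            ≤ ∑ k ∈ Finset.range N, 482 * n / ε' ^ 2 * (dyadicProb (J + k) : ℝ) :=
              Finset.sum_le_sum fun k hk => ht' k (Finset.mem_range.1 hk)
          _ ≤ 482 * n / ε' ^ 2 * (2 * (1 / 2) ^ J) := by
              rw [← Finset.mul_sum]
              gcongr
              exact sum_dyadicProb_le J N
          _ = 482 / ε' ^ 2 * (2 * (n * (1 / 2) ^ J)) := by ring
          _ ≤ 482 / ε' ^ 2 * (2 * (2 * X)) :=
              mul_le_mul_of_nonneg_left (mul_le_mul_of_nonneg_left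
                (mul_half_pow_le_rpow_of_lt_eight_pow hJ2) (by norm_num)) (by positivity)
          _ = _ := by ring
      -- `5784000 = 750 · 482 · 4 · 4`, one factor `4` coming from `ε' = ε/2` and the other from the
      -- geometric sum.
      calc ((c' * d : ℕ) : ℝ) * (750 * d * ∑ k ∈ Finset.range N, (t k : ℝ))
          ≤ ((c' * d : ℕ) : ℝ) * (750 * d * (482 / ε' ^ 2 * (4 * X))) := by gcongr
        _ = _ := by
            rw [hε']; push_cast; field_simp; ring
    push_cast at h2 ⊢
    have h3 : (d : ℝ) ^ 2 * X / ε ^ 2 ≤ 4 * (X * Real.logb 2 n ^ 2 / ε ^ 2) := by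
      calc (d : ℝ) ^ 2 * X / ε ^ 2 ≤ 4 * Real.logb 2 n ^ 2 * X / ε ^ 2 := by gcongr
        _ = _ := by ring
    have h4 : (7 + 5784000 * c' : ℝ) * (d ^ 2 * X / ε ^ 2) ≤
        (7 + 5784000 * c') * (4 * (X * Real.logb 2 n ^ 2 / ε ^ 2)) := by gcongr
    linarith
  · have h1 : ENNReal.ofReal (1 - 1 / (n : ℝ) ^ c) ≤
        ENNReal.ofReal (1 - N * (1 / 2) ^ (c' * d)) := by
      apply ENNReal.ofReal_le_ofReal
      gcongr
      -- The union bound over `N ≤ 2ᵈ` scales costs one power of `2ᵈ`, and `n ^ c ≤ (2ᵈ) ^ c` costs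
      -- `c` more; hence `c + 1 ≤ c'`.
      have hNd : (N : ℝ) ≤ 2 ^ d := by
        have : d < 2 ^ d := Nat.lt_two_pow_self
        exact_mod_cast (by omega : N ≤ 2 ^ d)
      rw [one_div_pow, mul_one_div, div_le_div_iff₀ (by positivity)
        (Real.rpow_pos_of_pos hn0 _), one_mul]
      have hnd3 : (n : ℝ) ≤ 2 ^ d := by exact_mod_cast hnd
      calc N * (n : ℝ) ^ c ≤ 2 ^ d * ((2 : ℝ) ^ d) ^ c := by gcongr
        _ = ((2 : ℝ) ^ d) ^ (c + 1) := by
            rw [Real.rpow_add (by positivity), Real.rpow_one, mul_comm]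
        _ ≤ ((2 : ℝ) ^ d) ^ (c' : ℝ) :=
            Real.rpow_le_rpow_of_exponent_le (one_le_pow₀ (by norm_num)) hc
        _ = 2 ^ (c' * d) := by rw [Real.rpow_natCast, ← pow_mul, mul_comm]
    refine h1.trans ((hA G).2.trans ?_)
    refine (A.toOuterMeasure).mono fun T hT => ?_
    have hm0 : (0 : ℝ) ≤ G.edgeSet.ncard := Nat.cast_nonneg _
    have hle : ε' * (G.edgeSet.ncard : ℝ) ≤ ε * G.edgeSet.ncard := by gcongr; linarith
    have hT1 := hT.1
    have hT2 := hT.2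
    exact ⟨by linarith, by linarith⟩

theorem mainTheorem3 (c : ℝ) (hc : 0 < c) :
    ∃ C : ℝ, 0 < C ∧
      ∃ A : (n : ℕ) → (ε : ℝ) → RandomizedISAlgorithm n,
        ∀ (n : ℕ) (ε : ℝ), 1 ≤ n → 0 < ε → ∀ G : SimpleGraph (Fin n),
          RandomizedISAlgorithm.QueriesAtMost (A n ε) G
            (C * (Real.logb 2 n ^ 5 / ε ^ 4
              + (n : ℝ) ^ (2 / 3 : ℝ) * Real.logb 2 n ^ 2 / ε ^ 2)) ∧
          ENNReal.ofReal (1 - 1 / (n : ℝ) ^ c) ≤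
            RandomizedISAlgorithm.successProb (A n ε) ε G := by
  obtain ⟨c', hc'⟩ := exists_nat_ge (c + 1)
  refine ⟨28 + 23136000 * c', by positivity, ?_⟩
  have key : ∀ (n : ℕ) (ε : ℝ), ∃ A : RandomizedISAlgorithm n, 1 ≤ n → 0 < ε →
      ∀ G : SimpleGraph (Fin n),
        A.QueriesAtMost G ((28 + 23136000 * c') * (Real.logb 2 n ^ 5 / ε ^ 4
              + (n : ℝ) ^ (2 / 3 : ℝ) * Real.logb 2 n ^ 2 / ε ^ 2)) ∧
        ENNReal.ofReal (1 - 1 / (n : ℝ) ^ c) ≤ A.successProb ε G := by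
    intro n ε
    by_cases h : 2 ≤ n ∧ 0 < ε ∧ ε < 1
    · obtain ⟨A, hA⟩ := exists_edge_estimator_of_lt_one hc.le hc' h.1 h.2.1 h.2.2
      refine ⟨A, fun h1 _ G => ⟨fun T hT => ((hA G).1 T hT).trans ?_, (hA G).2⟩⟩
      have : 0 ≤ Real.logb 2 n := Real.logb_nonneg (by norm_num) (by exact_mod_cast h1)
      gcongr
      -- The sampling term alone bounds the queries; the `ε⁻⁴` term is slack.
      exact le_add_of_nonneg_left (by positivity)
    -- For `ε ≥ 1` the lower bound `(1 - ε)m` is nonpositive, and for `n ≤ 1` there are no edges, so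
    -- `0` is a valid answer without queries.
    · refine ⟨PMF.pure (.output 0), fun h1 hε G => ⟨fun T hT => ?_, ?_⟩⟩
      · rw [PMF.support_pure, Set.mem_singleton_iff] at hT
        subst hT
        have : 0 ≤ Real.logb 2 n := Real.logb_nonneg (by norm_num) (by exact_mod_cast h1)
        simp only [ISDecisionTree.numQueries, Nat.cast_zero]
        positivity
      · have hmem : (ISDecisionTree.output 0 : ISDecisionTree n) ∈
            {T | IsApprox ε (G.edgeSet.ncard : ℝ) (T.eval G)} := by
          have hm0 : (0 : ℝ) ≤ G.edgeSet.ncard := Nat.cast_nonneg _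
          simp only [Set.mem_ofPred_eq, ISDecisionTree.eval, IsApprox]
          refine ⟨?_, by positivity⟩
          by_cases hn : 2 ≤ n
          · have : 1 ≤ ε := by
              by_contra! hlt
              exact h ⟨hn, hε, hlt⟩
            nlinarith
          · have h2 := two_mul_ncard_edgeSet_le G
            have h3 : n ^ 2 ≤ 1 ^ 2 := Nat.pow_le_pow_left (by omega) 2
            have h4 : G.edgeSet.ncard = 0 := by omega
            simp [h4]
        rw [RandomizedISAlgorithm.successProb, PMF.toOuterMeasure_pure_apply, if_pos hmem]
        rw [ENNReal.ofReal_le_one, sub_le_self_iff]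
        positivity
  choose A hA using key
  exact ⟨A, hA⟩

end Main
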